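/- All simplicial complexes are finite abstract simplicial complexes, and the empty set is a face of every complex that has a face; $\{\emptyset\}$ is the simplex of dimension $-1$. For a face $\sigma$ of $K$, the link is $\mathrm{lk}(\sigma,K)=\{\tau : \tau\cap\sigma=\emptyset,\ \tau\cup\sigma\in K\}$. The barycentric subdivision $\mathrm{sd}\,K$ has as faces the sets of nonempty faces of $K$ that are totally ordered by inclusion. An elementary collapse removes from a complex two faces $\sigma\subsetneq\tau$ such that $\tau$ is the only face properly containing $\sigma$; a complex is collapsible if a finite sequence of elementary collapses reduces it to a single point. A facet is an inclusion-wise maximal face; a complex is pure if all its facets have the same dimension. A complex satisfies (RC) if it has no nonempty face, or it becomes collapsible after removing some set (possibly empty) of its facets. A complex $K$ satisfies (HRC) if $\mathrm{lk}(\sigma,K)$ satisfies (RC) for every face $\sigma$ of $K$, including $\sigma=\emptyset$ (where the link is $K$ itself). A $k$-dimensional pure complex is shellable if its facets can be ordered $F_1,\dots,F_t$ so that for each $i\ge 2$ the complex $F_i\cap\bigcup_{j<i}F_j$ (facets being regarded as full simplices) is pure of dimension $k-1$. A pure $k$-dimensional complex $K$ is vertex decomposable if it is a $k$-simplex, or it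 has a vertex $v$ such that the complex $K-v$ of faces not containing $v$ is $k$-dimensional and vertex decomposable and $\mathrm{lk}(v,K)$ is $(k-1)$-dimensional and vertex decomposable. **Theorem.** Let $K$ be a pure simplicial complex of dimension $d\ge -1$ satisfying (HRC). Then the second barycentric subdivision $\mathrm{sd}^2K=\mathrm{sd}(\mathrm{sd}\,K)$ is shellable and vertex decomposable. -/

import Mathlib

/-- A finite abstract simplicial complex: a finite family of finite sets which is closed under
passing to subsets. The empty set counts as a face (of dimension `-1`), so that the complex
without any face and the complex whose only face is the empty set are different complexes. -/
@[ext]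
structure FinComplex (V : Type*) where
  /-- the faces, the empty face included -/
  faces : Set (Finset V)
  finite_faces : faces.Finite
  down_closed : ∀ ⦃s : Finset V⦄, s ∈ faces → ∀ ⦃t : Finset V⦄, t ⊆ s → t ∈ faces

namespace FinComplex

variable {V : Type*}

/-- `σ ∈ K` means that `σ` is a face of `K`. -/
instance : Membership (Finset V) (FinComplex V) := ⟨fun K σ => σ ∈ K.faces⟩

/-- A facet is an inclusion-wise maximal face. -/
def IsFacet (K : FinComplex V) (σ : Finset V) : Prop :=
  σ ∈ K ∧ ∀ τ ∈ K, σ ⊆ τ → τ = σ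

/-- `K` has a face, and all its facets have dimension `d`, that is, `d + 1` elements. In other
words, `K` is pure and of dimension `d ≥ -1`. -/
def PureOfDim (K : FinComplex V) (d : ℤ) : Prop :=
  (∃ σ, σ ∈ K) ∧ ∀ σ, K.IsFacet σ → (σ.card : ℤ) = d + 1

/-- The full simplex on the vertex set `σ`; it has dimension `σ.card - 1`. -/
def simplex (σ : Finset V) : FinComplex V where
  faces := {τ | τ ⊆ σ}
  finite_faces := by
    refine (σ.powerset.finite_toSet).subset fun τ hτ => ?_
    simpa using hτ
  down_closed := fun _ hs _ hts => hts.trans hs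

/-- The link of `σ` in `K`: all `τ` disjoint from `σ` such that `σ ∪ τ` is a face of `K`. -/
def link [DecidableEq V] (K : FinComplex V) (σ : Finset V) : FinComplex V where
  faces := {τ | Disjoint σ τ ∧ σ ∪ τ ∈ K.faces}
  finite_faces := K.finite_faces.subset fun _ hτ =>
    K.down_closed hτ.2 Finset.subset_union_right
  down_closed := fun _ hs _ hts =>
    ⟨hs.1.mono_right hts, K.down_closed hs.2 (Finset.union_subset_union_right hts)⟩

/-- `K - v`: remove the vertex `v` and all faces that contain it. -/
def deleteVertex (K : FinComplex V) (v : V) : FinComplex V where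
  faces := {τ | τ ∈ K.faces ∧ v ∉ τ}
  finite_faces := K.finite_faces.subset fun _ hτ => hτ.1
  down_closed := fun _ hs _ hts => ⟨K.down_closed hs.1 hts, fun hv => hs.2 (hts hv)⟩

/-- The barycentric subdivision: its vertices are the nonempty faces of `K`, and its faces are
the sets of nonempty faces of `K` that are totally ordered by inclusion. -/
def sd (K : FinComplex V) : FinComplex (Finset V) where
  faces := {C | (∀ σ ∈ C, σ ∈ K.faces ∧ σ.Nonempty) ∧
    ∀ σ ∈ C, ∀ τ ∈ C, σ ⊆ τ ∨ τ ⊆ σ}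
  finite_faces := by
    refine (K.finite_faces.toFinset.powerset.finite_toSet).subset fun C hC => ?_
    rw [Finset.mem_coe, Finset.mem_powerset]
    exact fun σ hσ => K.finite_faces.mem_toFinset.2 (hC.1 σ hσ).1
  down_closed := fun _ hs _ hts =>
    ⟨fun σ hσ => hs.1 σ (hts hσ), fun σ hσ τ hτ => hs.2 σ (hts hσ) τ (hts hτ)⟩

/-- `L` arises from `K` by an elementary collapse: there are faces `σ ⊂ τ` of `K` such that `τ`
is the only face of `K` properly containing `σ`, and `L` is `K` without `σ` and `τ`. -/
def ElementaryCollapse (K L : FinComplex V) : Prop :=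
  ∃ σ τ : Finset V, σ ∈ K ∧ τ ∈ K ∧ σ ⊂ τ ∧ (∀ ρ ∈ K, σ ⊂ ρ → ρ = τ) ∧
    L.faces = K.faces \ {σ, τ}

/-- `K` is collapsible: a finite sequence of elementary collapses leads from `K` to a point. -/
def Collapsible (K : FinComplex V) : Prop :=
  ∃ v : V, Relation.ReflTransGen ElementaryCollapse K (simplex {v})

/-- The removal-collapsibility condition (RC): `K` has no nonempty face, or `K` becomes
collapsible after removing some set `Φ` of facets of `K` (possibly none). -/
def RC (K : FinComplex V) : Prop :=
  (∀ σ ∈ K, σ = ∅) ∨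
    ∃ Φ : Set (Finset V), (∀ φ ∈ Φ, K.IsFacet φ) ∧
      ∃ L : FinComplex V, L.faces = K.faces \ Φ ∧ L.Collapsible

/-- The hereditary removal-collapsibility condition (HRC): the link of every face of `K`,
including the empty face, satisfies (RC). -/
def HRC [DecidableEq V] (K : FinComplex V) : Prop :=
  ∀ σ ∈ K, (K.link σ).RC

/-- For a sequence `F` of finite sets, each viewed as a full simplex: the intersection of `F i`
with the union of all `F j`, `j < i`. -/
def shellingOverlap {t : ℕ} (F : Fin t → Finset V) (i : Fin t) : FinComplex V where
  faces := {τ | τ ⊆ F i ∧ ∃ j < i, τ ⊆ F j}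
  finite_faces := (simplex (F i)).finite_faces.subset fun _ hτ => hτ.1
  down_closed := fun _ hs _ hts =>
    ⟨hts.trans hs.1, let ⟨j, hj, hsj⟩ := hs.2; ⟨j, hj, hts.trans hsj⟩⟩

/-- `K` is shellable: it is pure of some dimension `k`, and its facets can be listed without
repetition as `F 0, F 1, …` such that the intersection of each facet but the first one with the
union of the previous facets is pure of dimension `k - 1`. -/
def Shellable (K : FinComplex V) : Prop :=
  ∃ k : ℤ, K.PureOfDim k ∧
    ∃ (t : ℕ) (F : Fin t → Finset V), Function.Injective F ∧
      (∀ σ, K.IsFacet σ ↔ ∃ i, F i = σ) ∧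
      ∀ i : Fin t, 0 < (i : ℕ) → (shellingOverlap F i).PureOfDim (k - 1)

/-- Vertex decomposability of pure complexes: full simplices (including the one whose only face
is the empty set) are vertex decomposable, and a pure `d`-dimensional complex `K` is vertex
decomposable if it has a vertex `v` such that `K - v` is `d`-dimensional and vertex decomposable
and the link of `v` is `(d - 1)`-dimensional and vertex decomposable. -/
inductive VertexDecomposable [DecidableEq V] : FinComplex V → Prop
  | of_simplex (σ : Finset V) : VertexDecomposable (simplex σ)
  | shed (K : FinComplex V) (d : ℤ) (v : V)
      (hpure : K.PureOfDim d) (hv : {v} ∈ K)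
      (hdel_dim : (K.deleteVertex v).PureOfDim d)
      (hdel : VertexDecomposable (K.deleteVertex v))
      (hlink_dim : (K.link {v}).PureOfDim (d - 1))
      (hlink : VertexDecomposable (K.link {v})) : VertexDecomposable K

end FinComplex

/-! The complex sd K is the order complex of the poset of nonempty faces of K, and sd² K is the
order complex of the poset of nonempty chains of faces. The proof orders the vertices of sd K
recursively (`AtomPrefix`): each vertex after the first meets the earlier ones, inside its link, in
an initial segment of an ordering of the same kind.

Such an ordering makes sd² K vertex decomposable (`orderVD_chainsMeeting`). The chains meeting an
initial segment B form a neighbourhood of B in the second subdivision. Enlarging B by u adds the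
chains through u that miss B. The chain {u} is attached along the analogous neighbourhood in the
link of u. The larger new chains then arise by completing that initial segment to the whole link,
one dimension lower. Read backwards, this is a sequence of shedding vertices. Shellability follows
from vertex decomposability (`VertexDecomposable.shellable`).

The ordering comes from (HRC), by induction on the dimension of the links of K
(`atomPrefix_upperPart`). In the poset of faces above b, the link of a face u is the join of the
interval between b and u, a subdivided simplex boundary, with the faces above u, a subdivided link
of K. The link of b, with suitable facets removed, collapses to any prescribed vertex
(`collapse_to_vertex`), and the collapse is reversed. For a pair σ ⊂ τ, first τ is added: it meets
the earlier faces in its boundary without σ. Then σ is added: it meets them in its boundary joined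
with τ. Both are initial segments of the required kind (`prefixPath_pair`, `atomPrefix_Ioo`). The
removed facets come last, each attached along its entire boundary.

The flag for contractibility is needed because an initial segment of one factor, taken alone, is
shown to be an initial segment of a join only if it is contractible (`atomPrefix_join_aux`). -/

open Relation

/-! ### Recursive vertex orderings and their behaviour under joins. -/

section AtomOrderings

variable {α : Type*} [PartialOrder α]

open scoped Classical in
/-- The elements of `Q` that are comparable to `u` and different from it. -/
noncomputable def nbrs (Q : Finset α) (u : α) : Finset α := {x ∈ Q | x < u ∨ u < x}

theorem mem_nbrs {Q : Finset α} {u x : α} : x ∈ nbrs Q u ↔ x ∈ Q ∧ (x < u ∨ u < x) := by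
  simp [nbrs]

/-- Every element of `Q` is comparable to, and different from, every element of `R`. -/
def Joinable (Q R : Finset α) : Prop := ∀ x ∈ Q, ∀ y ∈ R, x < y ∨ y < x

theorem Joinable.symm {Q R : Finset α} (h : Joinable Q R) : Joinable R Q :=
  fun x hx y hy => (h y hy x hx).symm

theorem Joinable.mono {Q R Q' R' : Finset α} (h : Joinable Q R) (hQ : Q' ⊆ Q) (hR : R' ⊆ R) :
    Joinable Q' R' := fun x hx y hy => h x (hQ hx) y (hR hy)

theorem Joinable.notMem {Q R : Finset α} (h : Joinable Q R) {u : α} (hu : u ∈ Q) : u ∉ R :=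
  fun hR => (h u hu u hR).elim (lt_irrefl u) (lt_irrefl u)

theorem nbrs_eq_self {Q : Finset α} {u : α} (h : ∀ x ∈ Q, x < u ∨ u < x) : nbrs Q u = Q := by
  ext x; simp only [mem_nbrs]; exact ⟨fun h => h.1, fun hx => ⟨hx, h x hx⟩⟩

theorem nbrs_subset (Q : Finset α) (u : α) : nbrs Q u ⊆ Q := fun _ hx => (mem_nbrs.1 hx).1

variable [DecidableEq α]

/-- `AtomPrefix n Q A c`: the chains in `Q` form a complex of dimension `n - 1` whose vertices
have a recursive ordering with initial segment `A`. Every vertex `u` is added to the set `B` of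
the earlier ones in such a way that `B ∩ nbrs Q u` is an initial segment of such an ordering of
the link of `u`. If `c = true`, the initial segment `A` is moreover contractible, in the sense
that only contractible initial segments occur in the links of the elements of `A`. -/
def AtomPrefix : ℕ → Finset α → Finset α → Bool → Prop
  -- The empty segment is never contractible. Hence in dimension 0 the only contractible segments
  -- are single points.
  | 0, Q, A, c => Q = ∅ ∧ A = ∅ ∧ c = false
  | n + 1, Q, A, c => ∃ v ∈ Q, AtomPrefix n (nbrs Q v) (nbrs Q v) false ∧
      ReflTransGen (fun B B' => ∃ u ∈ Q, u ∉ B ∧ B' = insert u B ∧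
        AtomPrefix n (nbrs Q u) (B ∩ nbrs Q u) c) {v} A ∧
      ReflTransGen (fun B B' => ∃ u ∈ Q, u ∉ B ∧ B' = insert u B ∧
        AtomPrefix n (nbrs Q u) (B ∩ nbrs Q u) false) A Q

/-- One vertex is added to an initial segment `B` of a recursive ordering of `Q`. -/
def PrefixStep (n : ℕ) (Q : Finset α) (c : Bool) (B B' : Finset α) : Prop :=
  ∃ u ∈ Q, u ∉ B ∧ B' = insert u B ∧ AtomPrefix n (nbrs Q u) (B ∩ nbrs Q u) c

theorem atomPrefix_zero {Q A : Finset α} {c : Bool} :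
    AtomPrefix 0 Q A c ↔ Q = ∅ ∧ A = ∅ ∧ c = false := Iff.rfl

theorem AtomPrefix.weaken {n : ℕ} : ∀ {Q A : Finset α} {c : Bool},
    AtomPrefix n Q A c → AtomPrefix n Q A false := by
  induction n with
  | zero => exact fun h => ⟨h.1, h.2.1, rfl⟩
  | succ n ih =>
    rintro Q A c ⟨v, hv, hs, h1, h2⟩
    refine ⟨v, hv, hs, ReflTransGen.mono ?_ _ _ h1, h2⟩
    rintro B B' ⟨u, hu, huB, rfl, h⟩
    exact ⟨u, hu, huB, rfl, ih h⟩

theorem PrefixStep.weaken {n : ℕ} {Q B B' : Finset α} {c : Bool}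
    (h : PrefixStep n Q c B B') : PrefixStep n Q false B B' := by
  obtain ⟨u, hu, huB, rfl, h⟩ := h
  exact ⟨u, hu, huB, rfl, h.weaken⟩

theorem prefixPath_weaken {n : ℕ} {Q B B' : Finset α} {c : Bool}
    (h : ReflTransGen (PrefixStep n Q c) B B') : ReflTransGen (PrefixStep n Q false) B B' :=
  ReflTransGen.mono (fun _ _ h => PrefixStep.weaken h) _ _ h

theorem AtomPrefix.full {n : ℕ} {Q A : Finset α} {c : Bool} (h : AtomPrefix n Q A c) :
    AtomPrefix n Q Q false := by
  cases n with
  | zero => exact ⟨h.1, h.1, rfl⟩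
  | succ n =>
    obtain ⟨v, hv, hs, h1, h2⟩ := h
    exact ⟨v, hv, hs, (prefixPath_weaken h1).trans h2, .refl⟩

theorem prefixPath_subset {n : ℕ} {Q B B' : Finset α} {c : Bool}
    (h : ReflTransGen (PrefixStep n Q c) B B') : B ⊆ B' := by
  induction h with
  | refl => exact subset_rfl
  | tail _ h ih =>
    obtain ⟨u, hu, huB, rfl, h⟩ := h
    exact ih.trans (Finset.subset_insert _ _)

theorem AtomPrefix.subset {n : ℕ} {Q A : Finset α} {c : Bool} (h : AtomPrefix n Q A c) :
    A ⊆ Q := by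
  cases n with
  | zero => simp [h.2.1]
  | succ n =>
    obtain ⟨v, hv, hs, h1, h2⟩ := h
    exact prefixPath_subset h2

theorem nbrs_union (Q R : Finset α) (u : α) : nbrs (Q ∪ R) u = nbrs Q u ∪ nbrs R u := by
  ext x; simp only [mem_nbrs, Finset.mem_union]; tauto

theorem Joinable.nbrs_left {Q R : Finset α} (h : Joinable Q R) {u : α} (hu : u ∈ Q) :
    nbrs (Q ∪ R) u = nbrs Q u ∪ R := by
  rw [nbrs_union, nbrs_eq_self (Q := R) fun x hx => (h u hu x hx).symm]

theorem Joinable.inter_nbrs {Q R A B : Finset α} (h : Joinable Q R) {u : α} (hu : u ∈ Q)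
    (hA : A ⊆ Q) (hB : B ⊆ R) :
    (A ∪ B) ∩ nbrs (Q ∪ R) u = A ∩ nbrs Q u ∪ B := by
  rw [h.nbrs_left hu]
  ext x
  simp only [Finset.mem_inter, Finset.mem_union]
  constructor
  · rintro ⟨hx | hx, hy | hy⟩
    · exact .inl ⟨hx, hy⟩
    · exact absurd hy (h.notMem (hA hx))
    · exact .inr hx
    · exact .inr hx
  · rintro (hx | hx)
    · exact ⟨.inl hx.1, .inl hx.2⟩
    · exact ⟨.inr hx, .inr (hB hx)⟩

/-- An initial segment of an ordering of a join: both parts are initial segments, and if one of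
them is empty, then the other one is contractible. -/
theorem atomPrefix_join_aux (N : ℕ) : ∀ n m : ℕ, n + m = N → ∀ Q R : Finset α, Joinable Q R →
    (∀ A, AtomPrefix n Q A true → AtomPrefix m R R false →
      AtomPrefix (n + m) (Q ∪ R) A true) ∧
    (∀ A B c c', AtomPrefix n Q A c → AtomPrefix m R B c' →
      AtomPrefix (n + m) (Q ∪ R) (A ∪ B) (c || c')) := by
  induction N with
  | zero =>
    intro n m hnm Q R hQR
    obtain ⟨rfl, rfl⟩ : n = 0 ∧ m = 0 := by omega
    refine ⟨fun A h => by simp [atomPrefix_zero] at h, ?_⟩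
    rintro A B c c' ⟨rfl, rfl, rfl⟩ ⟨rfl, rfl, rfl⟩
    simp [atomPrefix_zero]
  | succ N ih =>
    have key : ∀ n m : ℕ, n + 1 + (m + 1) = N + 1 → ∀ Q R : Finset α, Joinable Q R →
        (∀ A, AtomPrefix (n + 1) Q A true → AtomPrefix (m + 1) R R false →
          AtomPrefix (n + 1 + (m + 1)) (Q ∪ R) A true) ∧
        (∀ A B c', AtomPrefix (n + 1) Q A true → AtomPrefix (m + 1) R B c' →
          AtomPrefix (n + 1 + (m + 1)) (Q ∪ R) (A ∪ B) true) ∧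
        (∀ A B, AtomPrefix (n + 1) Q A false → AtomPrefix (m + 1) R B false →
          AtomPrefix (n + 1 + (m + 1)) (Q ∪ R) (A ∪ B) false) := by
      intro n m hnm Q R hQR
      have e1 : n + 1 + (m + 1) = (n + (m + 1)) + 1 := by omega
      have e2 : n + 1 + (m + 1) = ((n + 1) + m) + 1 := by omega
      have e3 : n + (m + 1) = (n + 1) + m := by omega
      have jl : ∀ u, Joinable (nbrs Q u) R := fun u => hQR.mono (nbrs_subset _ _) subset_rfl
      have jr : ∀ u, Joinable Q (nbrs R u) := fun u => hQR.mono subset_rfl (nbrs_subset _ _)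
      -- a step in the left factor
      have stepL : ∀ {A A' B c c'}, AtomPrefix (m + 1) R B c' → A ⊆ Q → PrefixStep n Q c A A' →
          PrefixStep (n + (m + 1)) (Q ∪ R) (c || c') (A ∪ B) (A' ∪ B) := by
        rintro A A' B c c' hB hA ⟨u, hu, huA, rfl, h⟩
        refine ⟨u, by simp [hu], ?_, Finset.insert_union _ _ _, ?_⟩
        · simp only [Finset.mem_union, not_or]
          exact ⟨huA, fun h => hQR.notMem hu (hB.subset h)⟩
        · rw [hQR.inter_nbrs hu hA hB.subset, hQR.nbrs_left hu]
          exact (ih n (m + 1) (by omega) _ _ (jl u)).2 _ _ _ _ h hB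
      have stepR : ∀ {A B B' c c'}, AtomPrefix (n + 1) Q A c → B ⊆ R → PrefixStep m R c' B B' →
          PrefixStep (n + (m + 1)) (Q ∪ R) (c || c') (A ∪ B) (A ∪ B') := by
        rintro A B B' c c' hA hB ⟨u, hu, huB, rfl, h⟩
        refine ⟨u, by simp [hu], ?_, Finset.union_insert _ _ _, ?_⟩
        · simp only [Finset.mem_union, not_or]
          exact ⟨fun h => hQR.notMem (hA.subset h) hu, huB⟩
        · rw [Finset.union_comm Q R, Finset.union_comm A B, hQR.symm.inter_nbrs hu hB hA.subset,
            hQR.symm.nbrs_left hu, Finset.union_comm _ A, Finset.union_comm _ Q, e3]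
          exact (ih (n + 1) m (by omega) _ _ (jr u)).2 _ _ _ _ hA h
      have pathL : ∀ {A A' B c c'}, AtomPrefix (m + 1) R B c' →
          ReflTransGen (PrefixStep n Q c) A A' → A' ⊆ Q →
          ReflTransGen (PrefixStep (n + (m + 1)) (Q ∪ R) (c || c')) (A ∪ B) (A' ∪ B) := by
        intro A A' B c c' hB h hA'
        induction h with
        | refl => exact .refl
        | tail _ h ih' =>
          have : _ ⊆ Q := (prefixPath_subset (.single h)).trans hA'
          exact (ih' this).tail (stepL hB this h)
      have pathR : ∀ {A B B' c c'}, AtomPrefix (n + 1) Q A c →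
          ReflTransGen (PrefixStep m R c') B B' → B' ⊆ R →
          ReflTransGen (PrefixStep (n + (m + 1)) (Q ∪ R) (c || c')) (A ∪ B) (A ∪ B') := by
        intro A B B' c c' hA h hB'
        induction h with
        | refl => exact .refl
        | tail _ h ih' =>
          have : _ ⊆ R := (prefixPath_subset (.single h)).trans hB'
          exact (ih' this).tail (stepR hA this h)
      have finish : ∀ {A B c c'}, AtomPrefix (n + 1) Q A c → AtomPrefix (m + 1) R B c' →
          ReflTransGen (PrefixStep (n + (m + 1)) (Q ∪ R) false) (A ∪ B) (Q ∪ R) := by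
        intro A B c c' hA hB
        have hA' := hA.full
        obtain ⟨v, hv, hsv, h1, h2⟩ := hA
        have hB' := hB.weaken
        obtain ⟨w, hw, hsw, h3, h4⟩ := hB
        exact (pathL hB' h2 subset_rfl).trans (pathR hA' h4 subset_rfl)
      -- the first vertex, in the left factor
      have startL : ∀ {v}, v ∈ Q → AtomPrefix n (nbrs Q v) (nbrs Q v) false →
          AtomPrefix (m + 1) R R false →
          AtomPrefix (n + (m + 1)) (nbrs (Q ∪ R) v) (nbrs (Q ∪ R) v) false := by
        intro v hv hs hR
        rw [hQR.nbrs_left hv]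
        exact (ih n (m + 1) (by omega) _ _ (jl v)).2 _ _ _ _ hs hR
      -- contractible initial segments within the left factor
      have pathL₀ : ∀ {A A'}, AtomPrefix (m + 1) R R false →
          ReflTransGen (PrefixStep n Q true) A A' → A' ⊆ Q →
          ReflTransGen (PrefixStep (n + (m + 1)) (Q ∪ R) true) A A' := by
        intro A A' hR h hA'
        induction h with
        | refl => exact .refl
        | tail _ h ih' =>
          have hA : _ ⊆ Q := (prefixPath_subset (.single h)).trans hA'
          refine (ih' hA).tail ?_
          obtain ⟨u, hu, huA, rfl, h⟩ := h
          refine ⟨u, by simp [hu], huA, rfl, ?_⟩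
          have := hQR.inter_nbrs hu hA (Finset.empty_subset R)
          rw [Finset.union_empty, Finset.union_empty] at this
          rw [this, hQR.nbrs_left hu]
          exact (ih n (m + 1) (by omega) _ _ (jl u)).1 _ h hR
      -- Here `w` is attached along `A` alone, without any element of `R`. This is where
      -- contractibility of `A` is indispensable.
      have stepLR : ∀ {A w}, AtomPrefix (n + 1) Q A true → w ∈ R →
          AtomPrefix m (nbrs R w) (nbrs R w) false →
          PrefixStep (n + (m + 1)) (Q ∪ R) true A (A ∪ {w}) := by
        intro A w hA hw hs
        refine ⟨w, by simp [hw], fun h => hQR.notMem (hA.subset h) hw,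
          by rw [Finset.union_comm]; rfl, ?_⟩
        have := hQR.symm.inter_nbrs hw (Finset.empty_subset R) hA.subset
        rw [Finset.empty_union, Finset.empty_inter, Finset.empty_union] at this
        rw [Finset.union_comm Q R, this, hQR.symm.nbrs_left hw, Finset.union_comm _ Q, e3]
        exact (ih (n + 1) m (by omega) _ _ (jr w)).1 _ hA hs
      -- The flag is arbitrary: no step is needed to reach `{v}`, so a single vertex is always
      -- contractible.
      have single : ∀ {k : ℕ} {S : Finset α} {v : α}, v ∈ S →
          AtomPrefix k (nbrs S v) (nbrs S v) false → ReflTransGen (PrefixStep k S false) {v} S →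
          ∀ c, AtomPrefix (k + 1) S {v} c := fun hv hs h c => ⟨_, hv, hs, .refl, h⟩
      have partA : ∀ A, AtomPrefix (n + 1) Q A true → AtomPrefix (m + 1) R R false →
          AtomPrefix (n + 1 + (m + 1)) (Q ∪ R) A true := by
        intro A hA hR
        have hA0 := hA
        obtain ⟨v, hv, hsv, h1, h2⟩ := hA
        have hR0 := hR
        obtain ⟨w, hw, hsw, h3, h4⟩ := hR
        rw [e1]
        refine ⟨v, by simp [hv], startL hv hsv hR0, pathL₀ hR0 h1 hA0.subset, ?_⟩
        refine .head (stepLR hA0 hw hsw).weaken ?_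
        exact finish hA0 (single hw hsw (h3.trans h4) false)
      -- the left initial segment is contractible
      have partB : ∀ A B c', AtomPrefix (n + 1) Q A true → AtomPrefix (m + 1) R B c' →
          AtomPrefix (n + 1 + (m + 1)) (Q ∪ R) (A ∪ B) true := by
        intro A B c' hA hB
        have hA0 := hA
        obtain ⟨v, hv, hsv, h1, h2⟩ := hA
        have hB0 := hB
        obtain ⟨w, hw, hsw, h3, h4⟩ := hB
        rw [e1]
        refine ⟨v, by simp [hv], startL hv hsv hB0.full, ?_, finish hA0 hB0⟩
        -- Build `A`, attach the first vertex `w` of `B` along it, then add the rest of `B`. Those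
        -- later steps stay contractible because `A` is a factor of what they meet.
        exact ((pathL₀ hB0.full h1 hA0.subset).tail (stepLR hA0 hw hsw)).trans
          (pathR hA0 h3 hB0.subset)
      refine ⟨partA, partB, ?_⟩
      intro A B hA hB
      have hA0 := hA
      obtain ⟨v, hv, hsv, h1, h2⟩ := hA
      have hB0 := hB
      obtain ⟨w, hw, hsw, h3, h4⟩ := hB
      rw [e1]
      refine ⟨v, by simp [hv], startL hv hsv hB0.full, ?_, finish hA0 hB0⟩
      -- Without contractibility `A` cannot be built first. The single vertex `v` is contractible,
      -- so `w` can follow it at once, and then both parts are completed.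
      have hv' := single hv hsv (h1.trans h2)
      have hw' := single hw hsw (h3.trans h4)
      exact (ReflTransGen.single (stepLR (hv' true) hw hsw).weaken).trans
        ((pathL (hw' false) h1 hA0.subset).trans (pathR hA0 h3 hB0.subset))
    intro n m hnm Q R hQR
    rcases n with _ | n
    · refine ⟨fun A h => by simp [atomPrefix_zero] at h, ?_⟩
      rintro A B c c' ⟨rfl, rfl, rfl⟩ h
      simpa using h
    rcases m with _ | m
    · constructor
      · rintro A h ⟨rfl, -, -⟩
        simpa using h
      · rintro A B c c' h ⟨rfl, rfl, rfl⟩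
        simpa using h
    refine ⟨(key n m hnm Q R hQR).1, ?_⟩
    intro A B c c' hA hB
    cases c
    · cases c'
      · exact (key n m hnm Q R hQR).2.2 A B hA hB
      · rw [Finset.union_comm A B, Finset.union_comm Q R, add_comm]
        exact (key m n (by omega) R Q hQR.symm).2.1 B A _ hB hA
    · exact (key n m hnm Q R hQR).2.1 A B c' hA hB

theorem AtomPrefix.join_left {n m : ℕ} {Q R A : Finset α} (hQR : Joinable Q R)
    (hA : AtomPrefix n Q A true) (hR : AtomPrefix m R R false) :
    AtomPrefix (n + m) (Q ∪ R) A true :=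
  (atomPrefix_join_aux _ n m rfl Q R hQR).1 A hA hR

theorem AtomPrefix.join {n m : ℕ} {Q R A B : Finset α} {c c' : Bool} (hQR : Joinable Q R)
    (hA : AtomPrefix n Q A c) (hB : AtomPrefix m R B c') :
    AtomPrefix (n + m) (Q ∪ R) (A ∪ B) (c || c') :=
  (atomPrefix_join_aux _ n m rfl Q R hQR).2 A B c c' hA hB

end AtomOrderings

/-! ### Vertex decomposability of order complexes; cones. -/

section OrderComplexes

variable {β : Type*} [PartialOrder β]

/-- Vertex decomposability of the order complex of `C`, as a complex of dimension `n - 1`. -/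
inductive OrderVD [DecidableEq β] : ℕ → Finset β → Prop
  | chain (C : Finset β) (h : IsChain (· ≤ ·) (C : Set β)) : OrderVD C.card C
  | shed (n : ℕ) (C : Finset β) (v : β) (hv : v ∈ C) (hdel : OrderVD (n + 1) (C.erase v))
      (hlink : OrderVD n (nbrs C v)) : OrderVD (n + 1) C

/-- Every shedding vertex of the base also sheds the cone, because its deletion and its link in the
cone are again cones with apex `v`. -/
theorem OrderVD.insert_cone [DecidableEq β] {n : ℕ} {C : Finset β} {v : β} (h : OrderVD n C)
    (hv : ∀ x ∈ C, x < v ∨ v < x) : OrderVD (n + 1) (insert v C) := by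
  have hnot : ∀ {D : Finset β}, (∀ x ∈ D, x < v ∨ v < x) → v ∉ D :=
    fun h hD => (h v hD).elim (lt_irrefl v) (lt_irrefl v)
  induction h with
  | chain C h =>
    rw [← Finset.card_insert_of_notMem (hnot hv)]
    refine .chain _ ?_
    rw [Finset.coe_insert]
    exact h.insert fun x hx _ => ((hv x hx).symm).imp le_of_lt le_of_lt
  | shed n C w hw hdel hlink ih1 ih2 =>
    have hwv : w ≠ v := fun e => hnot hv (e ▸ hw)
    refine .shed _ _ w (Finset.mem_insert_of_mem hw) ?_ ?_
    · rw [Finset.erase_insert_of_ne hwv.symm]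
      exact ih1 fun x hx => hv x (Finset.mem_of_mem_erase hx)
    · have : nbrs (insert v C) w = insert v (nbrs C w) := by
        ext x
        simp only [mem_nbrs, Finset.mem_insert]
        have := hv w hw
        constructor
        · rintro ⟨h | h, h'⟩ <;> tauto
        · rintro (rfl | ⟨h, h'⟩) <;> tauto
      rw [this]
      exact ih2 fun x hx => hv x (mem_nbrs.1 hx).1

theorem OrderVD.union_chain [DecidableEq β] {n : ℕ} {C Z : Finset β} (h : OrderVD n C)
    (hZ : IsChain (· ≤ ·) (Z : Set β)) (hZC : Joinable Z C) : OrderVD (Z.card + n) (Z ∪ C) := by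
  induction Z using Finset.induction_on with
  | empty => simpa using h
  | insert z Z hz ih =>
    rw [Finset.card_insert_of_notMem hz, Finset.insert_union,
      show Z.card + 1 + n = (Z.card + n) + 1 by omega]
    rw [Finset.coe_insert] at hZ
    refine (ih (hZ.mono (Set.subset_insert _ _))
      (hZC.mono (Finset.subset_insert _ _) subset_rfl)).insert_cone ?_
    intro x hx
    rcases Finset.mem_union.1 hx with hx | hx
    · have hne : x ≠ z := fun e => hz (e ▸ hx)
      exact (hZ.total (Set.mem_insert_of_mem _ hx) (Set.mem_insert _ _)).imp
        (fun h => lt_of_le_of_ne h hne) (fun h => lt_of_le_of_ne h hne.symm)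
    · exact (hZC z (Finset.mem_insert_self _ _) x hx).symm

end OrderComplexes

/-! ### From recursive orderings to vertex decomposable posets of chains. -/

section Chains

variable {α : Type*} [PartialOrder α]

open scoped Classical in
/-- The elements of `Q` comparable to, and different from, all elements of `c`. -/
noncomputable def commonNbrs (Q c : Finset α) : Finset α := {x ∈ Q | ∀ y ∈ c, x < y ∨ y < x}

theorem mem_commonNbrs {Q c : Finset α} {x : α} :
    x ∈ commonNbrs Q c ↔ x ∈ Q ∧ ∀ y ∈ c, x < y ∨ y < x := by
  simp [commonNbrs]

theorem lt_or_lt_of_isChain {G : Finset α} (hG : IsChain (· ≤ ·) (G : Set α)) {x y : α}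
    (hx : x ∈ G) (hy : y ∈ G) (hne : x ≠ y) : x < y ∨ y < x :=
  (hG.total hx hy).imp (fun h => lt_of_le_of_ne h hne) (fun h => lt_of_le_of_ne h hne.symm)

theorem notMem_of_mem_commonNbrs {Q c : Finset α} {x : α} (hx : x ∈ commonNbrs Q c) : x ∉ c :=
  fun h => ((mem_commonNbrs.1 hx).2 x h).elim (lt_irrefl x) (lt_irrefl x)

variable [DecidableEq α]

open scoped Classical in
/-- The chains in `Q` that contain `c` and meet `B`. -/
noncomputable def chainsMeeting (Q c B : Finset α) : Finset (Finset α) :=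
  {G ∈ Q.powerset | IsChain (· ≤ ·) (G : Set α) ∧ c ⊆ G ∧ ∃ x ∈ G, x ∈ B}

theorem mem_chainsMeeting {Q c B G : Finset α} : G ∈ chainsMeeting Q c B ↔
    G ⊆ Q ∧ IsChain (· ≤ ·) (G : Set α) ∧ c ⊆ G ∧ ∃ x ∈ G, x ∈ B := by
  simp [chainsMeeting]

theorem nbrs_commonNbrs (Q c : Finset α) (u : α) :
    nbrs (commonNbrs Q c) u = commonNbrs Q (insert u c) := by
  ext x
  simp only [mem_nbrs, mem_commonNbrs, Finset.forall_mem_insert]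
  tauto

theorem isChain_insert_commonNbrs {Q c : Finset α} {u : α} (hc : IsChain (· ≤ ·) (c : Set α))
    (hu : u ∈ commonNbrs Q c) : IsChain (· ≤ ·) ((insert u c : Finset α) : Set α) := by
  rw [Finset.coe_insert]
  exact hc.insert fun x hx _ => ((mem_commonNbrs.1 hu).2 x hx).imp le_of_lt le_of_lt

theorem chainsMeeting_mono {Q c B B' : Finset α} (h : B ⊆ B') :
    chainsMeeting Q c B ⊆ chainsMeeting Q c B' := by
  intro G hG
  obtain ⟨h1, h2, h3, x, hx, hB⟩ := mem_chainsMeeting.1 hG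
  exact mem_chainsMeeting.2 ⟨h1, h2, h3, x, hx, h hB⟩

theorem chainsMeeting_empty (Q c : Finset α) : chainsMeeting Q c ∅ = ∅ := by
  ext G; simp [mem_chainsMeeting]

/-- Any element of a chain `G ⊇ c` outside `c` is comparable to all of `c`, so meeting the whole
link of `c` only says that `G` is larger than `c`. -/
theorem mem_chainsMeeting_commonNbrs {Q c G : Finset α} :
    G ∈ chainsMeeting Q c (commonNbrs Q c) ↔
      G ⊆ Q ∧ IsChain (· ≤ ·) (G : Set α) ∧ c ⊂ G := by
  rw [mem_chainsMeeting]
  constructor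
  · rintro ⟨h1, h2, h3, x, hx, hxc⟩
    exact ⟨h1, h2, Finset.ssubset_iff_subset_ne.2
      ⟨h3, fun e => notMem_of_mem_commonNbrs hxc (e ▸ hx)⟩⟩
  · rintro ⟨h1, h2, h3⟩
    obtain ⟨x, hx, hxc⟩ := Finset.exists_of_ssubset h3
    refine ⟨h1, h2, h3.1, x, hx, mem_commonNbrs.2 ⟨h1 hx, fun y hy => ?_⟩⟩
    exact lt_or_lt_of_isChain h2 hx (h3.1 hy) fun e => hxc (e ▸ hy)

/-- If `B` grows by `u`, the new chains are `insert u c` and the larger ones missing `B`. -/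
theorem chainsMeeting_insert {Q c B : Finset α} {u : α} (hcQ : c ⊆ Q)
    (hc : IsChain (· ≤ ·) (c : Set α)) (hu : u ∈ commonNbrs Q c) :
    chainsMeeting Q c (insert u B) = insert (insert u c) (chainsMeeting Q c B ∪
      chainsMeeting Q (insert u c) (commonNbrs Q (insert u c))) := by
  ext G
  rw [Finset.mem_insert, Finset.mem_union, mem_chainsMeeting_commonNbrs, mem_chainsMeeting,
    mem_chainsMeeting]
  constructor
  · rintro ⟨h1, h2, h3, x, hx, hxB⟩
    rcases Finset.mem_insert.1 hxB with rfl | hxB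
    · have : insert x c ⊆ G := Finset.insert_subset hx h3
      rcases this.eq_or_ssubset with e | h
      · exact .inl e.symm
      · exact .inr (.inr ⟨h1, h2, h⟩)
    · exact .inr (.inl ⟨h1, h2, h3, x, hx, hxB⟩)
  · rintro (rfl | ⟨h1, h2, h3, x, hx, hxB⟩ | ⟨h1, h2, h3⟩)
    · exact ⟨Finset.insert_subset (mem_commonNbrs.1 hu).1 hcQ, isChain_insert_commonNbrs hc hu,
        Finset.subset_insert _ _, u, Finset.mem_insert_self _ _, Finset.mem_insert_self _ _⟩
    · exact ⟨h1, h2, h3, x, hx, Finset.mem_insert_of_mem hxB⟩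
    · exact ⟨h1, h2, (Finset.subset_insert _ _).trans h3.1, u, h3.1 (Finset.mem_insert_self _ _),
        Finset.mem_insert_self _ _⟩

/-- In a chain through `u`, an element of `B` differs from `u` and is therefore one of its
neighbours. This identifies the old chains above `insert u c` with a neighbourhood in the link of
`u`. -/
theorem chainsMeeting_inter_nbrs {Q c B G : Finset α} {u : α} (hB : B ⊆ commonNbrs Q c)
    (huB : u ∉ B) : G ∈ chainsMeeting Q (insert u c) (B ∩ nbrs (commonNbrs Q c) u) ↔
      G ∈ chainsMeeting Q c B ∧ insert u c ⊆ G := by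
  rw [mem_chainsMeeting, mem_chainsMeeting]
  constructor
  · rintro ⟨h1, h2, h3, x, hx, hxB⟩
    exact ⟨⟨h1, h2, (Finset.subset_insert _ _).trans h3, x, hx, (Finset.mem_inter.1 hxB).1⟩, h3⟩
  · rintro ⟨⟨h1, h2, h3, x, hx, hxB⟩, h4⟩
    refine ⟨h1, h2, h4, x, hx, Finset.mem_inter.2 ⟨hxB, mem_nbrs.2 ⟨hB hxB, ?_⟩⟩⟩
    exact lt_or_lt_of_isChain h2 hx (h4 (Finset.mem_insert_self _ _)) fun e => huB (e ▸ hxB)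

theorem prefixPath_subset_right {n : ℕ} {Q B B' : Finset α} {b : Bool}
    (h : ReflTransGen (PrefixStep n Q b) B B') (hB : B ⊆ Q) : B' ⊆ Q := by
  induction h with
  | refl => exact hB
  | tail _ h ih =>
    obtain ⟨u, hu, huB, rfl, h⟩ := h
    exact Finset.insert_subset hu ih

/-- Growing an initial segment preserves vertex decomposability: the new chains can be shed. The
set `Y` contains further elements, of which exactly those in the chain `Z` are comparable to the
new chains. -/
theorem orderVD_of_prefixPath {Q : Finset α} (n : ℕ)
    (hM : ∀ m ≤ n, ∀ c B : Finset α, c ⊆ Q → IsChain (· ≤ ·) (c : Set α) →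
      AtomPrefix m (commonNbrs Q c) B false → OrderVD m (chainsMeeting Q c B)) :
    ∀ (c B B' : Finset α), c ⊆ Q → IsChain (· ≤ ·) (c : Set α) → B ⊆ commonNbrs Q c →
      ReflTransGen (PrefixStep n (commonNbrs Q c) false) B B' →
      ∀ Y Z : Finset (Finset α), Z ⊆ Y → IsChain (· ≤ ·) (Z : Set (Finset α)) →
      (∀ z ∈ Z, z ⊆ c) →
      (∀ G ∈ chainsMeeting Q c B', G ∉ chainsMeeting Q c B →
        G ∉ Y ∧ ∀ y ∈ Y, y < G ∨ G < y → y ∈ Z) →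
      OrderVD (Z.card + n + 1) (Y ∪ chainsMeeting Q c B) →
      OrderVD (Z.card + n + 1) (Y ∪ chainsMeeting Q c B') := by
  induction n using Nat.strong_induction_on with
  | _ n ih =>
  intro c B B' hcQ hc hBc hpath Y Z hZY hZ hZc hY hstart
  induction hpath with
  | refl => exact hstart
  | @tail B₁ B₂ hB₁ hstep ih' =>
    have hBB₁ := prefixPath_subset hB₁
    have hB₁c := prefixPath_subset_right hB₁ hBc
    have hB₂ := prefixPath_subset (.single hstep)
    specialize ih' fun G hG hG' => hY G (chainsMeeting_mono hB₂ hG) hG'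
    obtain ⟨u, hu, huB, rfl, hadm⟩ := hstep
    have huc := notMem_of_mem_commonNbrs hu
    set c' := insert u c with hc'
    have hc'Q : c' ⊆ Q := Finset.insert_subset (mem_commonNbrs.1 hu).1 hcQ
    have hc'c : IsChain (· ≤ ·) (c' : Set α) := isChain_insert_commonNbrs hc hu
    have hcc' : c ⊂ c' := Finset.ssubset_insert huc
    set T := chainsMeeting Q c B₁ with hT
    set W := chainsMeeting Q c' (commonNbrs Q c') with hW
    have hins : chainsMeeting Q c (insert u B₁) = insert c' (T ∪ W) :=
      chainsMeeting_insert hcQ hc hu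
    have hBi : ∀ G, G ∈ chainsMeeting Q c' (B₁ ∩ nbrs (commonNbrs Q c) u) ↔
        G ∈ T ∧ c' ⊆ G := fun G => chainsMeeting_inter_nbrs hB₁c huB
    have hc'T : c' ∉ T := by
      intro h
      obtain ⟨-, -, -, x, hx, hxB⟩ := mem_chainsMeeting.1 h
      rcases Finset.mem_insert.1 hx with rfl | hx
      · exact huB hxB
      · exact notMem_of_mem_commonNbrs (hB₁c hxB) hx
    have hnew : ∀ G, G ∈ insert c' W → G ∉ T → G ∉ Y ∧ ∀ y ∈ Y, y < G ∨ G < y → y ∈ Z := by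
      intro G hG hGT
      refine hY G ?_ fun h => hGT (chainsMeeting_mono hBB₁ h)
      rw [hins, Finset.mem_insert, Finset.mem_union]
      rcases Finset.mem_insert.1 hG with h | h <;> tauto
    obtain ⟨hc'Y, hc'Z⟩ := hnew c' (Finset.mem_insert_self _ _) hc'T
    have hZc' : ∀ z ∈ Z, z < c' := fun z hz => lt_of_le_of_lt (hZc z hz) hcc'
    -- No chain of `T` lies below `c'`, since `c'` misses `B₁`. So the link of `c'` is the chain `Z`
    -- joined with the chains of `T` above `c'`.
    have hlinkEq : nbrs (insert c' (Y ∪ T)) c' =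
        Z ∪ chainsMeeting Q c' (B₁ ∩ nbrs (commonNbrs Q c) u) := by
      ext G
      rw [mem_nbrs, Finset.mem_insert, Finset.mem_union, Finset.mem_union, hBi]
      constructor
      · rintro ⟨rfl | hG | hG, h⟩
        · exact absurd h (by simp)
        · exact .inl (hc'Z G hG h)
        · rcases h with h | h
          · exfalso
            obtain ⟨-, -, h3, x, hx, hxB⟩ := mem_chainsMeeting.1 hG
            have := h.1 hx
            rcases Finset.mem_insert.1 this with rfl | hx'
            · exact huB hxB
            · exact notMem_of_mem_commonNbrs (hB₁c hxB) hx'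
          · exact .inr ⟨hG, h.1⟩
      · rintro (hG | ⟨hG, h⟩)
        · exact ⟨.inr (.inl (hZY hG)), .inl (hZc' G hG)⟩
        · exact ⟨.inr (.inr hG), .inr (lt_of_le_of_ne h fun e => hc'T (e ▸ hG))⟩
    have hlink : OrderVD (Z.card + n) (nbrs (insert c' (Y ∪ T)) c') := by
      rw [hlinkEq]
      refine (hM n le_rfl c' _ hc'Q hc'c ?_).union_chain hZ ?_
      · rw [nbrs_commonNbrs] at hadm ⊢
        exact hadm
      · intro z hz G hG
        exact .inl (lt_of_lt_of_le (hZc' z hz) ((hBi G).1 hG).2)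
    have hE : OrderVD (Z.card + n + 1) (insert c' (Y ∪ T)) := by
      refine .shed _ _ c' (Finset.mem_insert_self _ _) ?_ hlink
      rw [Finset.erase_insert (by simp [hc'Y, hc'T])]
      exact ih'
    rw [hins]
    rw [nbrs_commonNbrs] at hadm
    rcases n with _ | n
    · have hW0 : W = ∅ := by rw [hW, hadm.1, chainsMeeting_empty]
      rwa [hW0, Finset.union_empty, Finset.union_insert]
    · obtain ⟨v, hv, hs, h1, h2⟩ := hadm
      have hc'Z' : c' ∉ Z := fun h => hc'Y (hZY h)
      -- The new chains properly above `c'` arise when the initial segment in the link of `u` is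
      -- completed, a case of smaller dimension. Now `c'` lies below all of them and joins `Z`. The
      -- chains of `T` not containing `c'` are incomparable to the ones still to be added and go
      -- into `Y`.
      have key := ih n (by omega) (fun m hm => hM m (by omega)) c'
        (B₁ ∩ commonNbrs Q c') (commonNbrs Q c') hc'Q hc'c Finset.inter_subset_right h2
        (insert c' (Y ∪ {G ∈ T | ¬ c' ⊆ G})) (insert c' Z) ?_ ?_ ?_ ?_ ?_
      · rw [Finset.card_insert_of_notMem hc'Z',
          show Z.card + 1 + n + 1 = Z.card + (n + 1) + 1 by omega] at key
        convert key using 1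
        ext G
        simp only [Finset.mem_union, Finset.mem_insert, Finset.mem_filter, ← hW]
        by_cases hG : G ∈ T
        · by_cases hcG : c' ⊆ G
          · rcases hcG.eq_or_ssubset with e | h
            · simp [e]
            · have : G ∈ W := by
                obtain ⟨h1, h2, -⟩ := mem_chainsMeeting.1 hG
                exact mem_chainsMeeting_commonNbrs.2 ⟨h1, h2, h⟩
              simp [this]
          · simp [hG, hcG]
        · simp only [hG, false_and, or_false, false_or]; tauto
      · exact Finset.insert_subset_insert _ (hZY.trans Finset.subset_union_left)
      · rw [Finset.coe_insert]
        exact hZ.insert fun z hz _ => .inr (hZc' z hz).le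
      · intro z hz
        rcases Finset.mem_insert.1 hz with rfl | hz
        · exact subset_rfl
        · exact (hZc' z hz).le
      · intro G hG hG'
        have hGc := (mem_chainsMeeting_commonNbrs.1 hG).2.2
        rw [← nbrs_commonNbrs, hBi] at hG'
        have hGT : G ∉ T := fun h => hG' ⟨h, hGc.1⟩
        obtain ⟨h3, h4⟩ := hnew G (Finset.mem_insert_of_mem hG) hGT
        constructor
        · simp only [Finset.mem_insert, Finset.mem_union, Finset.mem_filter, not_or]
          exact ⟨hGc.ne', h3, fun h => hGT h.1⟩
        · intro y hy hyG
          simp only [Finset.mem_insert, Finset.mem_union, Finset.mem_filter] at hy ⊢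
          rcases hy with rfl | hy | ⟨hy, hy'⟩
          · exact .inl rfl
          · exact .inr (h4 y hy hyG)
          · exfalso
            rcases hyG with h | h
            · apply hGT
              obtain ⟨h5, h6, -⟩ := mem_chainsMeeting_commonNbrs.1 hG
              obtain ⟨-, -, -, x, hx, hxB⟩ := mem_chainsMeeting.1 hy
              exact mem_chainsMeeting.2 ⟨h5, h6, hcc'.1.trans hGc.1, x, h.1 hx, hxB⟩
            · exact hy' (hGc.1.trans h.1)
      · rw [Finset.card_insert_of_notMem hc'Z',
          show Z.card + 1 + n + 1 = Z.card + (n + 1) + 1 by omega]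
        convert hE using 1
        ext G
        have hG := hBi G
        rw [nbrs_commonNbrs] at hG
        rw [Finset.mem_union, hG, Finset.mem_insert, Finset.mem_insert, Finset.mem_union,
          Finset.mem_union, Finset.mem_filter]
        by_cases h1 : G ∈ T <;> by_cases h2 : c' ⊆ G <;> simp [h1, h2]

/-- For the start `{v}` the poset is a cone with apex `insert v c` over the larger chains, which are
covered by induction. The other elements of `B` are added by `orderVD_of_prefixPath`, which at this
stage needs only the smaller dimensions. -/
theorem orderVD_chainsMeeting {Q : Finset α} (n : ℕ) :
    ∀ c B : Finset α, c ⊆ Q → IsChain (· ≤ ·) (c : Set α) →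
      AtomPrefix n (commonNbrs Q c) B false → OrderVD n (chainsMeeting Q c B) := by
  induction n using Nat.strong_induction_on with
  | _ n ih =>
    rcases n with _ | n
    · rintro c B hcQ hc ⟨-, rfl, -⟩
      rw [chainsMeeting_empty]
      exact .chain ∅ (by simp)
    · rintro c B hcQ hc ⟨v, hv, hs, h1, -⟩
      have := orderVD_of_prefixPath n (fun m hm => ih m (by omega)) c {v} B hcQ hc (by simpa) h1
        ∅ ∅ subset_rfl (by simp) (by simp) (by simp)
      simp only [Finset.card_empty, zero_add, Finset.empty_union] at this
      apply this
      have e := chainsMeeting_insert (B := ∅) hcQ hc hv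
      rw [chainsMeeting_empty, Finset.empty_union, insert_empty_eq] at e
      rw [e]
      rw [nbrs_commonNbrs] at hs
      refine (ih n (by omega) _ _ (Finset.insert_subset (mem_commonNbrs.1 hv).1 hcQ)
        (isChain_insert_commonNbrs hc hv) hs).insert_cone ?_
      intro G hG
      exact .inr (mem_chainsMeeting_commonNbrs.1 hG).2.2

end Chains

/-! ### Translation to simplicial complexes; vertex decomposable complexes are shellable. -/

namespace FinComplex

variable {V : Type*}

theorem mem_faces {K : FinComplex V} {σ : Finset V} : σ ∈ K.faces ↔ σ ∈ K := Iff.rfl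

theorem exists_isFacet {K : FinComplex V} {σ : Finset V} (hσ : σ ∈ K) :
    ∃ τ, K.IsFacet τ ∧ σ ⊆ τ := by
  obtain ⟨τ, hστ, hτ⟩ := K.finite_faces.exists_le_maximal hσ
  exact ⟨τ, ⟨hτ.1, fun ρ hρ h => le_antisymm (hτ.2 hρ h) h⟩, hστ⟩

/-- The order complex of a finite subset `C` of a partial order. -/
def orderComplex {β : Type*} [PartialOrder β] (C : Finset β) : FinComplex β where
  faces := {F | F ⊆ C ∧ IsChain (· ≤ ·) (F : Set β)}
  finite_faces := (simplex C).finite_faces.subset fun _ h => h.1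
  down_closed := fun _ hs _ hts => ⟨hts.trans hs.1, hs.2.mono (Finset.coe_subset.2 hts)⟩

theorem mem_orderComplex {β : Type*} [PartialOrder β] {C F : Finset β} :
    F ∈ orderComplex C ↔ F ⊆ C ∧ IsChain (· ≤ ·) (F : Set β) := Iff.rfl

theorem mem_link [DecidableEq V] {K : FinComplex V} {σ τ : Finset V} :
    τ ∈ K.link σ ↔ Disjoint σ τ ∧ σ ∪ τ ∈ K := Iff.rfl

theorem mem_deleteVertex {K : FinComplex V} {v : V} {τ : Finset V} :
    τ ∈ K.deleteVertex v ↔ τ ∈ K ∧ v ∉ τ := Iff.rfl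

theorem mem_simplex {σ τ : Finset V} : τ ∈ simplex σ ↔ τ ⊆ σ := Iff.rfl

theorem deleteVertex_orderComplex {β : Type*} [PartialOrder β] [DecidableEq β] (C : Finset β)
    (v : β) : (orderComplex C).deleteVertex v = orderComplex (C.erase v) := by
  ext F
  rw [mem_faces, mem_faces, mem_deleteVertex, mem_orderComplex, mem_orderComplex,
    Finset.subset_erase]
  tauto

theorem link_orderComplex {β : Type*} [PartialOrder β] [DecidableEq β] {C : Finset β} {v : β}
    (hv : v ∈ C) : (orderComplex C).link {v} = orderComplex (nbrs C v) := by
  ext F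
  rw [mem_faces, mem_faces, mem_link, mem_orderComplex, mem_orderComplex,
    Finset.disjoint_singleton_left]
  constructor
  · rintro ⟨h1, h2, h3⟩
    refine ⟨fun x hx => mem_nbrs.2 ⟨h2 (by simp [hx]), ?_⟩, h3.mono (by simp)⟩
    exact lt_or_lt_of_isChain h3 (by simp [hx]) (by simp) fun e => h1 (e ▸ hx)
  · rintro ⟨h1, h2⟩
    refine ⟨fun h => ?_, ?_, ?_⟩
    · have := mem_nbrs.1 (h1 h); simp at this
    · intro x hx
      rcases Finset.mem_union.1 hx with hx | hx
      · rwa [Finset.mem_singleton.1 hx]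
      · exact nbrs_subset _ _ (h1 hx)
    · rw [Finset.coe_union, Finset.coe_singleton, Set.singleton_union]
      exact h2.insert fun x hx _ => ((mem_nbrs.1 (h1 hx)).2.symm).imp le_of_lt le_of_lt

theorem IsFacet.deleteVertex {K : FinComplex V} {σ : Finset V} {v : V} (h : K.IsFacet σ)
    (hv : v ∉ σ) : (K.deleteVertex v).IsFacet σ :=
  ⟨⟨h.1, hv⟩, fun τ hτ hστ => h.2 τ hτ.1 hστ⟩

theorem IsFacet.link_singleton [DecidableEq V] {K : FinComplex V} {σ : Finset V} {v : V}
    (h : K.IsFacet σ) (hv : v ∈ σ) : (K.link {v}).IsFacet (σ.erase v) := by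
  have e : {v} ∪ σ.erase v = σ := by rw [Finset.singleton_union, Finset.insert_erase hv]
  refine ⟨⟨by simp, by rw [e]; exact h.1⟩, ?_⟩
  rintro τ ⟨h1, h2⟩ hστ
  rw [← h.2 _ h2 (by rw [← e]; exact Finset.union_subset_union_right hστ),
    Finset.singleton_union, Finset.erase_insert (by simpa using h1)]

/-- A facet avoiding `v` is a facet of the deletion; a facet containing `v` becomes a facet of the
link once `v` is dropped. -/
theorem pureOfDim_of_deleteVertex_of_link [DecidableEq V] {K : FinComplex V} {v : V} {d : ℤ}
    (h1 : (K.deleteVertex v).PureOfDim d) (h2 : (K.link {v}).PureOfDim (d - 1)) :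
    K.PureOfDim d := by
  obtain ⟨⟨τ, hτ⟩, h1⟩ := h1
  refine ⟨⟨τ, hτ.1⟩, fun σ hσ => ?_⟩
  by_cases hv : v ∈ σ
  · have := h2.2 _ (hσ.link_singleton hv)
    have := Finset.card_erase_add_one hv
    omega
  · exact h1 σ (hσ.deleteVertex hv)

theorem pureOfDim_simplex (σ : Finset V) : (simplex σ).PureOfDim (σ.card - 1) := by
  refine ⟨⟨σ, Finset.Subset.refl σ⟩, fun τ hτ => ?_⟩
  rw [hτ.2 σ (Finset.Subset.refl σ) hτ.1]; ring

theorem vertexDecomposable_orderComplex {β : Type*} [PartialOrder β] [DecidableEq β] {n : ℕ}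
    {C : Finset β} (h : OrderVD n C) :
    (orderComplex C).PureOfDim ((n : ℤ) - 1) ∧ (orderComplex C).VertexDecomposable := by
  induction h with
  | chain C h =>
    have : orderComplex C = simplex C := by
      ext F
      exact ⟨fun h => h.1, fun hF => ⟨hF, h.mono (Finset.coe_subset.2 hF)⟩⟩
    rw [this]
    exact ⟨pureOfDim_simplex C, .of_simplex C⟩
  | shed n C v hv hdel hlink ih1 ih2 =>
    rw [← deleteVertex_orderComplex] at ih1
    rw [← link_orderComplex hv] at ih2
    push_cast at ih1 ⊢
    have hp := pureOfDim_of_deleteVertex_of_link ih1.1 (d := (n : ℤ) + 1 - 1)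
      (by convert ih2.1 using 1; ring)
    refine ⟨hp, .shed _ _ v hp ⟨by simpa, by simp⟩ ih1.1 ih1.2 ?_ ih2.2⟩
    convert ih2.1 using 1; ring

/-- A list of sets of the same cardinality which in reverse order is a shelling. -/
def RevShelling [DecidableEq V] : List (Finset V) → Prop
  | [] => True
  | F :: l => F ∉ l ∧ RevShelling l ∧
      ∀ G ∈ l, ∃ H ∈ l, F ∩ G ⊆ H ∧ (F ∩ H).card + 1 = F.card

theorem RevShelling.nodup [DecidableEq V] {l : List (Finset V)} (h : RevShelling l) :
    l.Nodup := by
  induction l with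
  | nil => exact List.nodup_nil
  | cons F l ih => exact List.nodup_cons.2 ⟨h.1, ih h.2.1⟩

theorem RevShelling.getElem [DecidableEq V] {l : List (Finset V)} (h : RevShelling l) :
    ∀ (i j : ℕ) (_ : i < j) (hj : j < l.length), ∃ (k : ℕ) (_ : i < k) (hk : k < l.length),
      l[i] ∩ l[j] ⊆ l[k] ∧ (l[i] ∩ l[k]).card + 1 = l[i].card := by
  induction l with
  | nil => intro i j _ hj; simp at hj
  | cons F l ih =>
    intro i j hij hj
    obtain ⟨j, rfl⟩ : ∃ j', j = j' + 1 := ⟨j - 1, by omega⟩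
    simp only [List.length_cons] at hj
    rcases i with _ | i
    · obtain ⟨H, hH, h1, h2⟩ := h.2.2 l[j] (List.getElem_mem _)
      obtain ⟨k, hk, rfl⟩ := List.getElem_of_mem hH
      exact ⟨k + 1, by omega, by simpa using hk, by simpa using h1, by simpa using h2⟩
    · obtain ⟨k, h1, h2, h3, h4⟩ := ih h.2.1 i j (by omega) (by omega)
      exact ⟨k + 1, by omega, by simpa using h2, by simpa using h3, by simpa using h4⟩

/-- The facets of the deletion come first, then the cones over those of the link. Two cones are
compared through the shelling of the link. A cone over `F` meets a facet of the deletion inside `F`,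
which has codimension one and lies in some facet of the deletion. -/
theorem RevShelling.cone_append [DecidableEq V] {l₁ l₂ : List (Finset V)} {v : V}
    (h₁ : RevShelling l₁) (h₂ : RevShelling l₂) (hv₁ : ∀ F ∈ l₁, v ∉ F) (hv₂ : ∀ F ∈ l₂, v ∉ F)
    (h : ∀ F ∈ l₂, ∃ G ∈ l₁, F ⊆ G) : RevShelling (l₂.map (insert v) ++ l₁) := by
  induction l₂ with
  | nil => simpa using h₁
  | cons F l₂ ih =>
    simp only [List.forall_mem_cons] at hv₂ h
    have hF := hv₂.1
    obtain ⟨h21, h22, h23⟩ := h₂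
    rw [List.map_cons, List.cons_append]
    refine ⟨?_, ih h22 hv₂.2 h.2, ?_⟩
    · rw [List.mem_append, List.mem_map]
      rintro (⟨G, hG, e⟩ | h')
      · apply h21
        rwa [← Finset.erase_insert hF, ← e, Finset.erase_insert (hv₂.2 G hG)]
      · exact hv₁ _ h' (Finset.mem_insert_self _ _)
    · intro G hG
      rcases List.mem_append.1 hG with hG | hG
      · obtain ⟨G, hG', rfl⟩ := List.mem_map.1 hG
        obtain ⟨H, hH, h1, h2⟩ := h23 G hG'
        refine ⟨insert v H, List.mem_append.2 (.inl (List.mem_map.2 ⟨H, hH, rfl⟩)), ?_, ?_⟩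
        · rw [← Finset.insert_inter_distrib]
          exact Finset.insert_subset_insert _ h1
        · rw [← Finset.insert_inter_distrib, Finset.card_insert_of_notMem hF,
            Finset.card_insert_of_notMem (by simp [hF]), h2]
      · obtain ⟨H, hH, hFH⟩ := h.1
        refine ⟨H, List.mem_append.2 (.inr hH), ?_, ?_⟩
        · rw [Finset.insert_inter_of_notMem (hv₁ G hG)]
          exact Finset.inter_subset_left.trans hFH
        · rw [Finset.insert_inter_of_notMem (hv₁ H hH), Finset.inter_eq_left.2 hFH,
            Finset.card_insert_of_notMem hF]

theorem VertexDecomposable.exists_revShelling [DecidableEq V] {K : FinComplex V}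
    (h : K.VertexDecomposable) :
    ∃ l : List (Finset V), RevShelling l ∧ ∀ σ, K.IsFacet σ ↔ σ ∈ l := by
  induction h with
  | of_simplex σ =>
    refine ⟨[σ], ⟨by simp, trivial, by simp⟩, fun τ => ?_⟩
    rw [List.mem_singleton]
    constructor
    · exact fun h => (h.2 σ (Finset.Subset.refl σ) h.1).symm
    · rintro rfl
      exact ⟨Finset.Subset.refl τ, fun ρ hρ h => subset_antisymm hρ h⟩
  | shed K d v hpure hv hdel_dim hdel hlink_dim hlink ih1 ih2 =>
    obtain ⟨l₁, h₁, e₁⟩ := ih1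
    obtain ⟨l₂, h₂, e₂⟩ := ih2
    have hv₂ : ∀ F ∈ l₂, v ∉ F := fun F hF => by simpa using ((e₂ F).2 hF).1.1
    refine ⟨l₂.map (insert v) ++ l₁, h₁.cone_append h₂ (fun F hF => ((e₁ F).2 hF).1.2) hv₂ ?_, ?_⟩
    · intro F hF
      have : F ∈ K.deleteVertex v :=
        ⟨K.down_closed ((e₂ F).2 hF).1.2 Finset.subset_union_right, hv₂ F hF⟩
      obtain ⟨G, hG, hFG⟩ := exists_isFacet this
      exact ⟨G, (e₁ G).1 hG, hFG⟩
    · intro σ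
      rw [List.mem_append, List.mem_map]
      constructor
      · intro hσ
        by_cases hvσ : v ∈ σ
        · exact .inl ⟨σ.erase v, (e₂ _).1 (hσ.link_singleton hvσ), Finset.insert_erase hvσ⟩
        · exact .inr ((e₁ σ).1 (hσ.deleteVertex hvσ))
      · rintro (⟨F, hF, rfl⟩ | hσ)
        · have hF' := (e₂ F).2 hF
          refine ⟨by rw [← Finset.singleton_union]; exact hF'.1.2, fun τ hτ h => ?_⟩
          have hvτ : v ∈ τ := h (Finset.mem_insert_self _ _)
          have := hF'.2 (τ.erase v) ⟨by simp, by
            rw [Finset.singleton_union, Finset.insert_erase hvτ]; exact hτ⟩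
            (Finset.subset_erase.2 ⟨(Finset.subset_insert _ _).trans h, hv₂ F hF⟩)
          rw [← this, Finset.insert_erase hvτ]
        -- The deletion has the same dimension as `K`, so none of its facets can be properly
        -- contained in a face of `K`.
        · have hσ' := (e₁ σ).2 hσ
          obtain ⟨τ, hτ, hστ⟩ := exists_isFacet hσ'.1.1
          have := hpure.2 τ hτ
          have := hdel_dim.2 σ hσ'
          rwa [Finset.eq_of_subset_of_card_le hστ (by omega)]

/-- A maximal face of the overlap lies in the intersection with one earlier facet, hence in an
intersection of codimension one, and equals the latter by maximality. The list has the last facet at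
its head, whence `Fin.rev`. -/
theorem VertexDecomposable.shellable [DecidableEq V] {K : FinComplex V} {d : ℤ}
    (h : K.VertexDecomposable) (hd : K.PureOfDim d) : K.Shellable := by
  obtain ⟨l, hl, e⟩ := h.exists_revShelling
  refine ⟨d, hd, l.length, fun i => l[(Fin.rev i : Fin l.length)], ?_, ?_, ?_⟩
  · intro i j hij
    exact Fin.rev_injective (Fin.ext (hl.nodup.getElem_inj_iff.1 hij))
  · intro σ
    rw [e, List.mem_iff_getElem]
    constructor
    · rintro ⟨i, hi, rfl⟩
      exact ⟨Fin.rev ⟨i, hi⟩, by simp⟩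
    · rintro ⟨i, rfl⟩
      exact ⟨_, (Fin.rev i).2, rfl⟩
  · intro i hi
    constructor
    · exact ⟨∅, Finset.empty_subset _, ⟨0, by omega⟩, by simpa [Fin.lt_def] using hi,
        Finset.empty_subset _⟩
    · rintro τ ⟨⟨hτi, j, hj, hτj⟩, hmax⟩
      obtain ⟨k, hk, hkl, h1, h2⟩ := hl.getElem (Fin.rev i) (Fin.rev j)
        (Fin.rev_lt_rev.2 hj) (Fin.rev j).2
      have hik : τ ⊆ l[(Fin.rev i : Fin l.length)] ∩ l[k] :=
        Finset.subset_inter hτi ((Finset.subset_inter hτi hτj).trans h1)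
      have := hmax _ ⟨Finset.inter_subset_left, Fin.rev ⟨k, hkl⟩, by
        rw [Fin.rev_lt_iff]; exact hk, by simp⟩ hik
      have hc : (l[(Fin.rev i : Fin l.length)].card : ℤ) = d + 1 :=
        hd.2 _ ((e _).2 (List.getElem_mem _))
      rw [← this]
      simp only [Fin.getElem_fin] at h2 hc ⊢
      omega

/-- For a chain in `Q`, meeting `Q` means being nonempty, and containing `∅` is no condition. -/
theorem sd_sd_eq_orderComplex [DecidableEq V] (K : FinComplex V) {Q : Finset (Finset V)}
    (hQ : ∀ σ, σ ∈ Q ↔ σ ∈ K ∧ σ.Nonempty) :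
    K.sd.sd = orderComplex (chainsMeeting Q ∅ Q) := by
  have hch : ∀ {γ : Type _} (C : Finset (Finset γ)),
      (∀ σ ∈ C, ∀ τ ∈ C, σ ⊆ τ ∨ τ ⊆ σ) ↔ IsChain (· ≤ ·) (C : Set (Finset γ)) := by
    intro γ C
    constructor
    · exact fun h σ hσ τ hτ _ => h σ hσ τ hτ
    · exact fun h σ hσ τ hτ => h.total hσ hτ
  have hv : ∀ G : Finset (Finset V), G ∈ K.sd ∧ G.Nonempty ↔ G ∈ chainsMeeting Q ∅ Q := by
    intro G
    rw [mem_chainsMeeting]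
    constructor
    · rintro ⟨⟨h1, h2⟩, x, hx⟩
      have hGQ : G ⊆ Q := fun σ hσ => (hQ σ).2 (h1 σ hσ)
      exact ⟨hGQ, (hch G).1 h2, Finset.empty_subset _, x, hx, hGQ hx⟩
    · rintro ⟨h1, h2, -, x, hx, -⟩
      exact ⟨⟨fun σ hσ => (hQ σ).1 (h1 hσ), (hch G).2 h2⟩, x, hx⟩
  ext C
  change ((∀ G ∈ C, G ∈ K.sd ∧ G.Nonempty) ∧ ∀ σ ∈ C, ∀ τ ∈ C, σ ⊆ τ ∨ τ ⊆ σ) ↔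
    C ⊆ chainsMeeting Q ∅ Q ∧ IsChain (· ≤ ·) (C : Set (Finset (Finset V)))
  rw [hch C]
  refine and_congr_left fun _ => ?_
  exact forall₂_congr fun G _ => hv G

end FinComplex

/-! ### Intervals in Boolean lattices and the attachment of a collapsing pair. -/

section Intervals

variable {V : Type*}

open scoped Classical in
/-- The elements of `Q` that properly contain `u`. -/
noncomputable def upperPart (Q : Finset (Finset V)) (u : Finset V) : Finset (Finset V) :=
  {x ∈ Q | u < x}

theorem mem_upperPart {Q : Finset (Finset V)} {u x : Finset V} :
    x ∈ upperPart Q u ↔ x ∈ Q ∧ u < x := by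
  simp [upperPart]

variable [DecidableEq V]

/-- Links split into a part below and a part above, to which the join lemma applies. -/
theorem nbrs_eq_Ioo_union_upperPart {Q : Finset (Finset V)} {b u : Finset V}
    (hQ : ∀ x ∈ Q, b < x) (hQ' : ∀ y ∈ Q, Finset.Ioo b y ⊆ Q) (hu : u ∈ Q) :
    nbrs Q u = Finset.Ioo b u ∪ upperPart Q u := by
  ext x
  rw [mem_nbrs, Finset.mem_union, Finset.mem_Ioo, mem_upperPart]
  constructor
  · rintro ⟨hx, h | h⟩
    · exact .inl ⟨hQ x hx, h⟩
    · exact .inr ⟨hx, h⟩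
  · rintro (h | h)
    · exact ⟨hQ' u hu (Finset.mem_Ioo.2 h), .inl h.2⟩
    · exact ⟨h.1, .inr h.2⟩

theorem joinable_Ioo_upperPart (Q : Finset (Finset V)) (b u : Finset V) :
    Joinable (Finset.Ioo b u) (upperPart Q u) := fun _ hx _ hy =>
  .inl ((Finset.mem_Ioo.1 hx).2.trans (mem_upperPart.1 hy).2)

theorem upperPart_Ioo {b u t : Finset V} (hu : b < u) :
    upperPart (Finset.Ioo b t) u = Finset.Ioo u t := by
  ext x
  rw [mem_upperPart, Finset.mem_Ioo, Finset.mem_Ioo]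
  exact ⟨fun h => ⟨h.2, h.1.2⟩, fun h => ⟨⟨hu.trans h.1, h.2⟩, h.1⟩⟩

/-- An initial segment of the faces above `b` can be extended by `τ` and then by `σ ⊂ τ`, if `σ`
is the only face below `τ` that is missing. -/
theorem prefixPath_pair {n k₁ m₁ k₀ m₀ : ℕ} {Q A : Finset (Finset V)} {b σ τ : Finset V}
    (hQ : ∀ x ∈ Q, b < x) (hQ' : ∀ y ∈ Q, Finset.Ioo b y ⊆ Q) (hσ : σ ∈ Q) (hτ : τ ∈ Q)
    (hστ : σ < τ) (hσA : σ ∉ A) (hτA : τ ∉ A)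
    (hAτ : ∀ x, x ∈ A ∧ (x < τ ∨ τ < x) ↔ (b < x ∧ x < τ) ∧ x ≠ σ)
    (hAσ : ∀ x, x ∈ A ∧ (x < σ ∨ σ < x) ↔ b < x ∧ x < σ)
    (h₁ : AtomPrefix k₁ (Finset.Ioo b τ) ((Finset.Ioo b τ).erase σ) true)
    (h₂ : AtomPrefix m₁ (upperPart Q τ) (upperPart Q τ) false) (hn₁ : k₁ + m₁ = n)
    (h₃ : AtomPrefix k₀ (Finset.Ioo b σ) (Finset.Ioo b σ) false)
    (h₄ : AtomPrefix m₀ (upperPart Q σ) {τ} true) (hn₀ : k₀ + m₀ = n) :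
    ReflTransGen (PrefixStep n Q true) A (insert σ (insert τ A)) := by
  refine .tail (.single ⟨τ, hτ, hτA, rfl, ?_⟩) ⟨σ, hσ, ?_, rfl, ?_⟩
  -- Nothing above `τ` is present yet, so `τ` is attached along a segment of the lower factor alone,
  -- which is contractible by `h₁`.
  · have e : A ∩ nbrs Q τ = (Finset.Ioo b τ).erase σ := by
      ext x
      have := hAτ x
      rw [Finset.mem_inter, mem_nbrs, Finset.mem_erase, Finset.mem_Ioo]
      constructor
      · tauto
      · intro h
        have := this.2 ⟨h.2, h.1⟩
        exact ⟨this.1, hQ' τ hτ (Finset.mem_Ioo.2 h.2), this.2⟩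
    rw [e, nbrs_eq_Ioo_union_upperPart hQ hQ' hτ, ← hn₁]
    exact h₁.join_left (joinable_Ioo_upperPart _ _ _) h₂
  · simp [hσA, hστ.ne]
  -- Now `σ` meets the whole lower factor and, above, only `τ`; the contractible upper segment makes
  -- the join contractible.
  · have e : insert τ A ∩ nbrs Q σ = Finset.Ioo b σ ∪ {τ} := by
      ext x
      have := hAσ x
      rw [Finset.mem_inter, mem_nbrs, Finset.mem_union, Finset.mem_singleton, Finset.mem_Ioo,
        Finset.mem_insert]
      constructor
      · tauto
      · rintro (h | rfl)
        · have := this.2 h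
          exact ⟨.inr this.1, hQ' σ hσ (Finset.mem_Ioo.2 h), this.2⟩
        · exact ⟨.inl rfl, hτ, .inr hστ⟩
    rw [e, nbrs_eq_Ioo_union_upperPart hQ hQ' hσ, ← hn₀]
    exact h₃.join (joinable_Ioo_upperPart _ _ _) h₄

theorem Ioo_eq_empty_of_card {σ ρ : Finset V} (h : ρ.card ≤ σ.card + 1) :
    Finset.Ioo σ ρ = ∅ := by
  ext x
  simp only [Finset.mem_Ioo, Finset.notMem_empty, iff_false, not_and]
  intro h1 h2
  have := Finset.card_lt_card h1
  have := Finset.card_lt_card h2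
  omega

theorem atomPrefix_empty : AtomPrefix 0 (∅ : Finset (Finset V)) ∅ false := ⟨rfl, rfl, rfl⟩

theorem ssubset_of_ssubset_insert {x a : Finset V} {w : V} (h : x < insert w a) (hw : w ∉ x)
    (hne : x ≠ a) : x < a :=
  lt_of_le_of_ne (fun _ hy => (Finset.mem_insert.1 (h.1 hy)).resolve_left
    fun e => hw (e ▸ hy)) hne

/-- The interval between `σ` and `insert w κ`, with initial segments: the atom `insert w σ`, and
everything except `κ`. -/
theorem atomPrefix_Ioo_insert {k : ℕ}
    (ih : ∀ j < k + 1, ∀ σ ρ : Finset V, σ < ρ → ρ.card = σ.card + j + 1 →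
      AtomPrefix j (Finset.Ioo σ ρ) (Finset.Ioo σ ρ) false ∧
      (∀ w ∈ ρ, w ∉ σ → insert w σ < ρ → AtomPrefix j (Finset.Ioo σ ρ) {insert w σ} true) ∧
      (∀ w ∈ ρ, w ∉ σ → σ < ρ.erase w →
        AtomPrefix j (Finset.Ioo σ ρ) ((Finset.Ioo σ ρ).erase (ρ.erase w)) true))
    {σ κ : Finset V} {w : V} (hw : w ∉ κ) (hσκ : σ < κ) (hcard : κ.card = σ.card + k + 1) :
    insert w σ ∈ Finset.Ioo σ (insert w κ) ∧
    AtomPrefix k (nbrs (Finset.Ioo σ (insert w κ)) (insert w σ))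
      (nbrs (Finset.Ioo σ (insert w κ)) (insert w σ)) false ∧
    ReflTransGen (PrefixStep k (Finset.Ioo σ (insert w κ)) true) {insert w σ}
      ((Finset.Ioo σ (insert w κ)).erase κ) ∧
    ReflTransGen (PrefixStep k (Finset.Ioo σ (insert w κ)) false)
      ((Finset.Ioo σ (insert w κ)).erase κ) (Finset.Ioo σ (insert w κ)) := by
  set ρ := insert w κ with hρ
  have hwσ : w ∉ σ := fun h => hw (hσκ.1 h)
  have hρc : ρ.card = κ.card + 1 := Finset.card_insert_of_notMem hw
  have hκρ : κ < ρ := Finset.ssubset_insert hw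
  have hins : ∀ a, a < κ → insert w a < ρ := fun a ha => by
    refine lt_of_le_of_ne (Finset.insert_subset_insert _ ha.1) fun e => ha.ne ?_
    rw [← Finset.erase_insert hw, ← hρ, ← e, Finset.erase_insert fun h => hw (ha.1 h)]
  have hQ : ∀ x ∈ Finset.Ioo σ ρ, σ < x := fun x hx => (Finset.mem_Ioo.1 hx).1
  have hQ' : ∀ y ∈ Finset.Ioo σ ρ, Finset.Ioo σ y ⊆ Finset.Ioo σ ρ := fun y hy x hx =>
    Finset.mem_Ioo.2 ⟨(Finset.mem_Ioo.1 hx).1, (Finset.mem_Ioo.1 hx).2.trans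
      (Finset.mem_Ioo.1 hy).2⟩
  have hτ : insert w σ ∈ Finset.Ioo σ ρ :=
    Finset.mem_Ioo.2 ⟨Finset.ssubset_insert hwσ, hins σ hσκ⟩
  have hτc : (insert w σ).card = σ.card + 1 := Finset.card_insert_of_notMem hwσ
  refine ⟨hτ, ?_, ?_, ?_⟩
  · rw [nbrs_eq_Ioo_union_upperPart hQ hQ' hτ, upperPart_Ioo (Finset.ssubset_insert hwσ),
      Ioo_eq_empty_of_card (by omega), Finset.empty_union]
    exact (ih k (by omega) _ _ (hins σ hσκ) (by omega)).1
  · have path : ∀ S : Finset (Finset V), S ⊆ Finset.Ioo σ κ →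
        (∀ x ∈ S, ∀ y, σ < y → y ⊆ x → y ∈ S) →
        ReflTransGen (PrefixStep k (Finset.Ioo σ ρ) true) {insert w σ}
          (insert (insert w σ) (S ∪ S.image (insert w))) := by
      intro S
      -- Without `κ` the interval is a cone with apex `insert w σ`, built by reversing its collapse
      -- through the pairs `a ⊂ insert w a`. With increasing cardinality, everything below `a` is
      -- present and nothing above it.
      refine Finset.induction_on_max_value Finset.card S ?_ ?_
      · intro _ _; simpa using ReflTransGen.refl
      · intro a S haS hmax ihS hS hdown
        obtain ⟨haS', hSκ⟩ := Finset.insert_subset_iff.1 hS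
        obtain ⟨hσa, haκ⟩ := Finset.mem_Ioo.1 haS'
        have hwa : w ∉ a := fun h => hw (haκ.1 h)
        have hwS : ∀ x ∈ S, w ∉ x := fun x hx h =>
          hw ((Finset.mem_Ioo.1 (hSκ hx)).2.1 h)
        have hdownS : ∀ x ∈ S, ∀ y, σ < y → y ⊆ x → y ∈ S := by
          intro x hx y hy hyx
          rcases Finset.mem_insert.1 (hdown x (Finset.mem_insert_of_mem hx) y hy hyx) with rfl | h
          · rw [Finset.eq_of_subset_of_card_le hyx (hmax x hx)]; exact hx
          · exact h
        have hbelow : ∀ y, σ < y → y < a → y ∈ S := fun y hy hya =>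
          (Finset.mem_insert.1 (hdown a (Finset.mem_insert_self _ _) y hy hya.1)).resolve_left
            hya.ne
        have hnot : ∀ x ∈ S, ¬ a ⊆ x := fun x hx h =>
          haS (by rwa [Finset.eq_of_subset_of_card_le h (hmax x hx)])
        have hinsub : ∀ x y : Finset V, w ∉ x → x ⊆ insert w y → x ⊆ y := fun x y hx h =>
          (Finset.subset_insert_iff_of_notMem hx).1 h
        have hacard := Finset.card_lt_card hσa
        have haκcard := Finset.card_lt_card haκ
        have hwac : (insert w a).card = a.card + 1 := Finset.card_insert_of_notMem hwa
        have hwaa : a < insert w a := Finset.ssubset_insert hwa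
        have e : insert (insert w σ) (insert a S ∪ (insert a S).image (insert w)) =
            insert a (insert (insert w a) (insert (insert w σ) (S ∪ S.image (insert w)))) := by
          ext x
          simp only [Finset.mem_insert, Finset.mem_union, Finset.image_insert]
          tauto
        rw [e]
        refine (ihS hSκ hdownS).trans ?_
        have i1 := (ih (a.card - σ.card) (by omega) σ (insert w a) (hσa.trans hwaa)
          (by omega)).2.2 w (Finset.mem_insert_self _ _) hwσ
        rw [Finset.erase_insert hwa] at i1
        refine prefixPath_pair (k₁ := a.card - σ.card) (m₁ := ρ.card - a.card - 2)
          (k₀ := a.card - σ.card - 1) (m₀ := ρ.card - a.card - 1) hQ hQ'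
          (Finset.mem_Ioo.2 ⟨hσa, haκ.trans hκρ⟩)
          (Finset.mem_Ioo.2 ⟨hσa.trans hwaa, hins a haκ⟩) hwaa ?_ ?_ ?_ ?_ (i1 hσa) ?_ (by omega)
          ?_ ?_ (by omega)
        · simp only [Finset.mem_insert, Finset.mem_union, Finset.mem_image, not_or, not_exists,
            not_and]
          exact ⟨fun e => hwa (e ▸ Finset.mem_insert_self _ _), haS,
            fun x _ e => hwa (e ▸ Finset.mem_insert_self _ _)⟩
        · simp only [Finset.mem_insert, Finset.mem_union, Finset.mem_image, not_or, not_exists,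
            not_and]
          refine ⟨fun e => ?_, fun h => hwS _ h (Finset.mem_insert_self _ _), fun x hx e => ?_⟩
          · rw [e] at hwac; omega
          · apply hnot x hx
            rw [← Finset.erase_insert hwa, ← e, Finset.erase_insert (hwS x hx)]
        · intro x
          simp only [Finset.mem_insert, Finset.mem_union, Finset.mem_image]
          constructor
          · rintro ⟨rfl | hx | ⟨y, hy, rfl⟩, h⟩
            · refine ⟨⟨Finset.ssubset_insert hwσ, ?_⟩,
                fun e => hwa (e ▸ Finset.mem_insert_self _ _)⟩
              refine lt_of_le_of_ne (Finset.insert_subset_insert _ hσa.1) fun e => ?_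
              rw [e] at hτc; omega
            · refine ⟨⟨(Finset.mem_Ioo.1 (hSκ hx)).1, h.resolve_right fun h => ?_⟩,
                fun e => haS (e ▸ hx)⟩
              exact hwS x hx (h.1 (Finset.mem_insert_self _ _))
            · refine ⟨⟨(Finset.mem_Ioo.1 (hSκ hy)).1.trans (Finset.ssubset_insert (hwS y hy)),
                h.resolve_right fun h => ?_⟩, fun e => hwa (e ▸ Finset.mem_insert_self _ _)⟩
              exact hnot y hy (hinsub a y hwa (hwaa.1.trans h.1))
          · rintro ⟨⟨h1, h2⟩, h3⟩
            refine ⟨?_, .inl h2⟩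
            by_cases hwx : w ∈ x
            · have hx : insert w (x.erase w) = x := Finset.insert_erase hwx
              have h4 : σ ≤ x.erase w := Finset.subset_erase.2 ⟨h1.1, hwσ⟩
              rcases h4.eq_or_lt with h4 | h4
              · left; rw [h4, hx]
              · refine .inr (.inr ⟨_, hbelow _ h4 ?_, hx⟩)
                refine lt_of_le_of_ne (fun y hy => ?_) fun e => h2.ne (by rw [← hx, e])
                exact (Finset.mem_insert.1 (h2.1 (Finset.mem_of_mem_erase hy))).resolve_left
                  (Finset.ne_of_mem_erase hy)
            · exact .inr (.inl (hbelow x h1 (ssubset_of_ssubset_insert h2 hwx h3)))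
        · intro x
          simp only [Finset.mem_insert, Finset.mem_union, Finset.mem_image]
          constructor
          · rintro ⟨rfl | hx | ⟨y, hy, rfl⟩, h⟩
            · exfalso
              rcases h with h | h
              · exact hwa (h.1 (Finset.mem_insert_self _ _))
              · have := Finset.card_lt_card h; omega
            · exact ⟨(Finset.mem_Ioo.1 (hSκ hx)).1, h.resolve_right fun h => hnot x hx h.1⟩
            · exfalso
              rcases h with h | h
              · exact hwa (h.1 (Finset.mem_insert_self _ _))
              · exact hnot y hy (hinsub a y hwa h.1)
          · rintro ⟨h1, h2⟩
            exact ⟨.inr (.inl (hbelow x h1 h2)), .inl h2⟩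
        · rw [upperPart_Ioo (hσa.trans hwaa)]
          exact (ih _ (by omega) _ _ (hins a haκ) (by omega)).1
        · exact (ih _ (by omega) _ _ hσa (by omega)).1
        · rw [upperPart_Ioo hσa]
          exact (ih _ (by omega) _ _ (haκ.trans hκρ) (by omega)).2.1 w
            (Finset.mem_insert_self _ _) hwa (hins a haκ)
    convert path (Finset.Ioo σ κ) subset_rfl ?_ using 1
    · ext x
      simp only [Finset.mem_insert, Finset.mem_union, Finset.mem_image, Finset.mem_erase,
        Finset.mem_Ioo]
      constructor
      · rintro ⟨h1, h2, h3⟩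
        by_cases hwx : w ∈ x
        · have hx : insert w (x.erase w) = x := Finset.insert_erase hwx
          have h4 : σ ≤ x.erase w := Finset.subset_erase.2 ⟨h2.1, hwσ⟩
          rcases h4.eq_or_lt with h4 | h4
          · left; rw [h4, hx]
          · refine .inr (.inr ⟨_, ⟨h4, ?_⟩, hx⟩)
            refine lt_of_le_of_ne (fun y hy => ?_) fun e => h3.ne (by rw [← hx, e])
            exact (Finset.mem_insert.1 (h3.1 (Finset.mem_of_mem_erase hy))).resolve_left
              (Finset.ne_of_mem_erase hy)
        · exact .inr (.inl ⟨h2, ssubset_of_ssubset_insert h3 hwx h1⟩)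
      · rintro (rfl | ⟨h1, h2⟩ | ⟨y, ⟨h1, h2⟩, rfl⟩)
        · exact ⟨fun e => hw (e ▸ Finset.mem_insert_self _ _), Finset.mem_Ioo.1 hτ⟩
        · exact ⟨h2.ne, h1, h2.trans hκρ⟩
        · exact ⟨fun e => hw (e ▸ Finset.mem_insert_self _ _),
            lt_of_lt_of_le h1 (Finset.subset_insert _ _), hins y h2⟩
    · intro x hx y hy hyx
      exact Finset.mem_Ioo.2 ⟨hy, lt_of_le_of_lt hyx (Finset.mem_Ioo.1 hx).2⟩
  -- The last element `κ` is attached along its whole boundary, so this step carries the flag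
  -- `false`.
  · have hκQ : κ ∈ Finset.Ioo σ ρ := Finset.mem_Ioo.2 ⟨hσκ, hκρ⟩
    refine .single ⟨κ, hκQ, by simp, (Finset.insert_erase hκQ).symm, ?_⟩
    have e : nbrs (Finset.Ioo σ ρ) κ = Finset.Ioo σ κ := by
      rw [nbrs_eq_Ioo_union_upperPart hQ hQ' hκQ, upperPart_Ioo hσκ,
        Ioo_eq_empty_of_card (σ := κ) (by omega), Finset.union_empty]
    have e' : (Finset.Ioo σ ρ).erase κ ∩ Finset.Ioo σ κ = Finset.Ioo σ κ := by
      refine Finset.inter_eq_right.2 fun x hx => ?_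
      exact Finset.mem_erase.2 ⟨(Finset.mem_Ioo.1 hx).2.ne, hQ' κ hκQ hx⟩
    rw [e, e']
    exact (ih k (by omega) σ κ hσκ hcard).1

/-- Any element of `ρ \ σ` can serve as the apex in `atomPrefix_Ioo_insert`. The resulting ordering
gives all three claims, by cutting it after the first atom, before the last coatom, or not at all.
-/
theorem atomPrefix_Ioo (k : ℕ) : ∀ σ ρ : Finset V, σ < ρ → ρ.card = σ.card + k + 1 →
    AtomPrefix k (Finset.Ioo σ ρ) (Finset.Ioo σ ρ) false ∧
    (∀ w ∈ ρ, w ∉ σ → insert w σ < ρ → AtomPrefix k (Finset.Ioo σ ρ) {insert w σ} true) ∧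
    (∀ w ∈ ρ, w ∉ σ → σ < ρ.erase w →
      AtomPrefix k (Finset.Ioo σ ρ) ((Finset.Ioo σ ρ).erase (ρ.erase w)) true) := by
  induction k using Nat.strong_induction_on with
  | _ k ih =>
    intro σ ρ hσρ hcard
    rcases k with _ | k
    · rw [Ioo_eq_empty_of_card (by omega)]
      refine ⟨atomPrefix_empty, fun w _ hw h => ?_, fun w hw _ h => ?_⟩
      · have := Finset.card_lt_card h
        rw [Finset.card_insert_of_notMem hw] at this; omega
      · have := Finset.card_lt_card h
        rw [Finset.card_erase_of_mem hw] at this; omega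
    · have core : ∀ w ∈ ρ, w ∉ σ → _ := fun w hw hwσ =>
        atomPrefix_Ioo_insert (k := k) ih (σ := σ) (κ := ρ.erase w) (w := w) (by simp)
          (lt_of_le_of_ne (Finset.subset_erase.2 ⟨hσρ.1, hwσ⟩) fun e => by
            have := congrArg Finset.card e
            rw [Finset.card_erase_of_mem hw] at this; omega)
          (by rw [Finset.card_erase_of_mem hw]; omega)
      have core2 : ∀ w ∈ ρ, w ∉ σ → AtomPrefix (k + 1) (Finset.Ioo σ ρ) {insert w σ} true ∧
          AtomPrefix (k + 1) (Finset.Ioo σ ρ) ((Finset.Ioo σ ρ).erase (ρ.erase w)) true := by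
        intro w hw hwσ
        have := core w hw hwσ
        rw [Finset.insert_erase hw] at this
        obtain ⟨h1, h2, h3, h4⟩ := this
        exact ⟨⟨_, h1, h2, .refl, (prefixPath_weaken h3).trans h4⟩, ⟨_, h1, h2, h3, h4⟩⟩
      obtain ⟨w, hw, hwσ⟩ := Finset.exists_of_ssubset hσρ
      exact ⟨(core2 w hw hwσ).1.full, fun w hw hwσ _ => (core2 w hw hwσ).1,
        fun w hw hwσ _ => (core2 w hw hwσ).2⟩

end Intervals

namespace FinComplex

/-! ### A collapsible complex collapses to each of its vertices. -/

section Collapses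

variable {V : Type*}

theorem collapse_subset {K L : FinComplex V} (h : ReflTransGen ElementaryCollapse K L) :
    L.faces ⊆ K.faces := by
  induction h with
  | refl => exact subset_rfl
  | tail _ h ih =>
    obtain ⟨s, t, -, -, -, -, e⟩ := h
    exact (e ▸ Set.sdiff_subset).trans ih

theorem empty_mem_of_collapse {K : FinComplex V} {v : V}
    (h : ReflTransGen ElementaryCollapse K (simplex {v})) : ∅ ∈ K :=
  collapse_subset h (Finset.empty_subset _)

theorem singleton_mem_of_collapse {K : FinComplex V} {v : V}
    (h : ReflTransGen ElementaryCollapse K (simplex {v})) : {v} ∈ K :=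
  collapse_subset h (Finset.Subset.refl {v})

variable [DecidableEq V]

/-- The larger face of a collapsing pair has exactly one more element. -/
theorem eq_insert_of_free {K : FinComplex V} {s t : Finset V} (ht : t ∈ K) (hst : s ⊂ t)
    (hfree : ∀ ρ ∈ K, s ⊂ ρ → ρ = t) {x : V} (hx : x ∈ t) (hxs : x ∉ s) : insert x s = t :=
  hfree _ (K.down_closed ht (Finset.insert_subset hx hst.1)) (Finset.ssubset_insert hxs)

/-- A collapse to `u` can be redirected along an edge attached at `u`. -/
theorem collapse_of_attached_edge {M : FinComplex V} {u w : V}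
    (h : ReflTransGen ElementaryCollapse M (simplex {u})) : {w} ∉ M →
    ∀ N : FinComplex V, N.faces = M.faces ∪ {{w}, {w, u}} →
      ReflTransGen ElementaryCollapse N (simplex {w}) := by
  induction h using ReflTransGen.head_induction_on with
  | refl =>
    intro hw N hN
    have hwu : w ≠ u := by rintro rfl; exact hw (Finset.Subset.refl {w})
    have hmem : ∀ ρ, ρ ∈ N ↔ (ρ = ∅ ∨ ρ = {u}) ∨ ρ = {w} ∨ ρ = {w, u} := by
      intro ρ
      rw [← mem_faces, hN]
      simp only [Set.mem_union, Set.mem_insert_iff, Set.mem_singleton_iff]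
      rw [mem_faces, mem_simplex, Finset.subset_singleton_iff]
    -- Only the edge is left; removing it together with its end `u` leaves `w`.
    refine .single ⟨{u}, {w, u}, (hmem _).2 (by simp), (hmem _).2 (by simp), ?_, ?_, ?_⟩
    · exact Finset.ssubset_insert (by simpa using hwu)
    · intro ρ hρ h
      rcases (hmem ρ).1 hρ with (rfl | rfl) | rfl | rfl
      · simp at h
      · exact absurd h (by simp)
      · exact absurd (h.1 (Finset.mem_singleton_self u)) (by simpa using hwu.symm)
      · rfl
    · ext ρ
      simp only [Set.mem_sdiff, Set.mem_insert_iff, Set.mem_singleton_iff, not_or]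
      rw [mem_faces, mem_faces, hmem, mem_simplex, Finset.subset_singleton_iff]
      have h1 : ({w} : Finset V) ≠ {u} := by simpa using hwu
      have h2 : ({w} : Finset V) ≠ {w, u} := fun e => hwu
        (by have : u ∈ ({w} : Finset V) := e ▸ (by simp)
            exact (Finset.mem_singleton.1 this).symm)
      constructor
      · rintro (rfl | rfl)
        · exact ⟨.inl (.inl rfl), (Finset.singleton_ne_empty u).symm,
            (Finset.insert_ne_empty w {u}).symm⟩
        · exact ⟨.inr (.inl rfl), h1, h2⟩
      · tauto
  | @head M₁ M₂ hM h ih =>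
    intro hw N hN
    obtain ⟨s, t, hs, ht, hst, hfree, e⟩ := hM
    have hM₂ : ∀ ρ, ρ ∈ M₂ ↔ ρ ∈ M₁ ∧ ρ ≠ s ∧ ρ ≠ t := by
      intro ρ
      rw [← mem_faces, e]
      simp only [Set.mem_sdiff, Set.mem_insert_iff, Set.mem_singleton_iff, not_or, mem_faces]
    have h0 := empty_mem_of_collapse h
    have hu := singleton_mem_of_collapse h
    have hwM : ∀ ρ ∈ M₁, w ∉ ρ := fun ρ hρ hwρ =>
      hw (M₁.down_closed hρ (Finset.singleton_subset_iff.2 hwρ))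
    have hsub : ∀ ρ : Finset V, ρ ⊆ {w, u} → w ∉ ρ → ρ ∈ M₂ := by
      intro ρ h h'
      rcases Finset.subset_singleton_iff.1 ((Finset.subset_insert_iff_of_notMem h').1 h)
        with rfl | rfl
      · exact h0
      · exact hu
    -- The collapse of `M₁` is performed in the presence of the edge. The only faces of `M₁` inside
    -- the edge are `∅` and `{u}`, and both survive, so `s` remains free.
    let N₂ : FinComplex V :=
      { faces := M₂.faces ∪ {{w}, {w, u}}
        finite_faces := M₂.finite_faces.union (by simp)
        down_closed := by
          rintro ρ hρ π hπ
          rcases hρ with hρ | hρ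
          · exact .inl (M₂.down_closed hρ hπ)
          · have hρ' : ρ ⊆ {w, u} := by
              rcases hρ with rfl | rfl <;> simp
            by_cases hwπ : w ∈ π
            · right
              by_cases huπ : u ∈ π
              · right
                exact subset_antisymm (hπ.trans hρ')
                  (Finset.insert_subset hwπ (Finset.singleton_subset_iff.2 huπ))
              · left
                refine subset_antisymm (fun x hx => ?_) (Finset.singleton_subset_iff.2 hwπ)
                rcases Finset.mem_insert.1 (hρ' (hπ hx)) with rfl | hx'
                · simp
                · exact absurd (Finset.mem_singleton.1 hx' ▸ hx) huπ
            · exact .inl (hsub π (hπ.trans hρ') hwπ) }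
    refine .head ⟨s, t, ?_, ?_, hst, ?_, ?_⟩
      (ih (fun hw' => hw ((hM₂ _).1 hw').1) N₂ rfl)
    · rw [← mem_faces, hN]; exact .inl hs
    · rw [← mem_faces, hN]; exact .inl ht
    · intro ρ hρ hsρ
      rw [← mem_faces, hN] at hρ
      rcases hρ with hρ | hρ
      · exact hfree ρ hρ hsρ
      · have hρ' : ρ ⊆ {w, u} := by
          rcases hρ with rfl | rfl <;> simp
        exact absurd rfl ((hM₂ s).1 (hsub s (hsρ.1.trans hρ') (hwM s hs))).2.1
    · have hmem : ∀ ρ ∈ ({{w}, {w, u}} : Set (Finset V)), w ∈ ρ := by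
        rintro ρ (rfl | rfl) <;> simp
      rw [hN, Set.union_sdiff_distrib, ← e]
      change M₂.faces ∪ _ = M₂.faces ∪ _
      congr 1
      refine (Disjoint.sdiff_eq_left ?_).symm
      rw [Set.disjoint_right]
      rintro ρ (rfl | rfl) h
      · exact hwM _ hs (hmem _ h)
      · exact hwM _ ht (hmem _ h)

/-- A complex that collapses to one of its vertices collapses to all of them. -/
theorem collapse_to_vertex {K : FinComplex V} {v : V}
    (h : ReflTransGen ElementaryCollapse K (simplex {v})) : ∀ {w : V}, {w} ∈ K →
      ReflTransGen ElementaryCollapse K (simplex {w}) := by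
  induction h using ReflTransGen.head_induction_on with
  | refl =>
    intro w hw
    have : w = v := by simpa [mem_simplex] using hw
    rw [this]
  | @head K₁ K₂ hK h ih =>
    intro w hw
    have hK' := hK
    obtain ⟨s, t, hs, ht, hst, hfree, e⟩ := hK
    have hK₂ : ∀ ρ, ρ ∈ K₂ ↔ ρ ∈ K₁ ∧ ρ ≠ s ∧ ρ ≠ t := by
      intro ρ
      rw [← mem_faces, e]
      simp only [Set.mem_sdiff, Set.mem_insert_iff, Set.mem_singleton_iff, not_or, mem_faces]
    by_cases hw₂ : {w} ∈ K₂
    · exact .head hK' (ih hw₂)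
    -- Otherwise this step removes `{w}`. As `∅` survives, `{w}` must be the smaller face of the
    -- pair and the larger one an edge `{w, u}`, so `K₁` is `K₂` with an edge attached at `u`.
    have hs0 : s ≠ ∅ := fun h0 => ((hK₂ ∅).1 (empty_mem_of_collapse h)).2.1 h0.symm
    have hwt : ({w} : Finset V) ≠ t := fun e => hs0 (Finset.ssubset_singleton_iff.1 (e ▸ hst))
    have hws : {w} = s := by
      by_contra h
      exact hw₂ ((hK₂ _).2 ⟨hw, h, hwt⟩)
    obtain ⟨u, hut, hus⟩ := Finset.exists_of_ssubset hst
    have ht' : t = {w, u} := by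
      rw [← eq_insert_of_free ht hst hfree hut hus, ← hws]
      exact Finset.pair_comm _ _
    have hu₂ : {u} ∈ K₂ := by
      refine (hK₂ _).2 ⟨K₁.down_closed ht (Finset.singleton_subset_iff.2 hut), ?_, ?_⟩
      · exact fun e => hus (e ▸ Finset.mem_singleton_self u)
      · exact fun e => hs0 (Finset.ssubset_singleton_iff.1 (e ▸ hst))
    refine collapse_of_attached_edge (ih hu₂) hw₂ K₁ ?_
    rw [e, hws, ← ht', Set.sdiff_union_of_subset]
    rintro ρ (rfl | rfl)
    · exact hs
    · exact ht

end Collapses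

/-! ### Recursive orderings from (HRC). -/

section MainInduction

variable {V : Type*}

theorem PureOfDim.card_le {K : FinComplex V} {d : ℤ} (h : K.PureOfDim d) {σ : Finset V}
    (hσ : σ ∈ K) : (σ.card : ℤ) ≤ d + 1 := by
  obtain ⟨τ, hτ, hστ⟩ := exists_isFacet hσ
  have := h.2 τ hτ
  have := Finset.card_le_card hστ
  omega

variable [DecidableEq V]

theorem union_lt_union_iff {b s t : Finset V} (hs : Disjoint b s) (ht : Disjoint b t) :
    b ∪ s < b ∪ t ↔ s < t := by
  have key : ∀ {s t : Finset V}, Disjoint b s → (b ∪ s ⊆ b ∪ t ↔ s ⊆ t) := by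
    refine fun {s t} hs => ⟨fun h x hx => ?_, Finset.union_subset_union_right⟩
    exact (Finset.mem_union.1 (h (Finset.mem_union_right _ hx))).resolve_left
      fun hb => Finset.disjoint_left.1 hs hb hx
  change b ∪ s ⊂ b ∪ t ↔ s ⊂ t
  rw [Finset.ssubset_def, Finset.ssubset_def, key hs, key ht]

theorem exists_eq_union {b x : Finset V} (h : b ≤ x) : ∃ y, Disjoint b y ∧ x = b ∪ y :=
  ⟨x \ b, Finset.disjoint_sdiff, (Finset.union_sdiff_of_subset h).symm⟩

open scoped Classical in
/-- The elements `b ∪ y` of `Q` with `y ∈ M`. -/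
noncomputable def liftFaces (Q : Finset (Finset V)) (b : Finset V) (M : FinComplex V) :
    Finset (Finset V) := {x ∈ Q | x \ b ∈ M}

theorem mem_liftFaces {Q : Finset (Finset V)} {b y : Finset V} {M : FinComplex V}
    (h : Disjoint b y) : b ∪ y ∈ liftFaces Q b M ↔ b ∪ y ∈ Q ∧ y ∈ M := by
  simp [liftFaces, Finset.union_sdiff_cancel_left h]

theorem liftFaces_subset (Q : Finset (Finset V)) (b : Finset V) (M : FinComplex V) :
    liftFaces Q b M ⊆ Q := by
  classical exact Finset.filter_subset _ _

/-- Elements that depend only on the initial segment `A` can be added to it in any order. -/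
theorem prefixPath_of_nbrs_subset {n : ℕ} {Q A : Finset (Finset V)} (hA : A ⊆ Q)
    (h : ∀ u ∈ Q, u ∉ A → nbrs Q u ⊆ A ∧ AtomPrefix n (nbrs Q u) (nbrs Q u) false) :
    ReflTransGen (PrefixStep n Q false) A Q := by
  have key : ∀ T ⊆ Q, ReflTransGen (PrefixStep n Q false) A (A ∪ T) := by
    intro T
    induction T using Finset.induction_on with
    | empty => intro _; rw [Finset.union_empty]
    | insert u T huT ih =>
      intro hT
      obtain ⟨hu, hT⟩ := Finset.insert_subset_iff.1 hT
      rw [Finset.union_insert]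
      by_cases huA : u ∈ A
      · rw [Finset.insert_eq_of_mem (by simp [huA])]
        exact ih hT
      · refine (ih hT).tail ⟨u, hu, by simp [huA, huT], rfl, ?_⟩
        rw [Finset.inter_eq_right.2 ((h u hu huA).1.trans Finset.subset_union_left)]
        exact (h u hu huA).2
  have := key Q subset_rfl
  rwa [Finset.union_eq_right.2 hA] at this

/-- In a pure complex satisfying (HRC), the faces above `b` have a recursive ordering, which may
start with any of the minimal ones. -/
theorem atomPrefix_upperPart {K : FinComplex V} {d : ℤ} (hpure : K.PureOfDim d) (hHRC : K.HRC)
    {F : Finset (Finset V)} (hF : ∀ σ, σ ∈ F ↔ σ ∈ K) (n : ℕ) :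
    ∀ b ∈ K, (b.card : ℤ) + n = d + 1 →
      AtomPrefix n (upperPart F b) (upperPart F b) false ∧
      ∀ τ ∈ upperPart F b, τ.card = b.card + 1 → AtomPrefix n (upperPart F b) {τ} true := by
  induction n using Nat.strong_induction_on with
  | _ n ih =>
  intro b hb hbn
  set Q := upperPart F b with hQdef
  have hmemQ : ∀ x, x ∈ Q ↔ x ∈ K ∧ b < x := fun x => by rw [hQdef, mem_upperPart, hF]
  rcases n with _ | n
  · have hQ0 : Q = ∅ := by
      refine Finset.eq_empty_of_forall_notMem fun x hx => ?_
      have := Finset.card_lt_card ((hmemQ x).1 hx).2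
      have := hpure.card_le ((hmemQ x).1 hx).1
      omega
    rw [hQ0]
    exact ⟨atomPrefix_empty, by simp⟩
  suffices main : ∀ τ ∈ Q, τ.card = b.card + 1 → AtomPrefix (n + 1) Q {τ} true by
    refine ⟨?_, main⟩
    obtain ⟨φ, hφ, hbφ⟩ := exists_isFacet hb
    have hφc := hpure.2 φ hφ
    obtain ⟨w, hw, hwb⟩ := Finset.exists_mem_notMem_of_card_lt_card
      (show b.card < φ.card by push_cast at hbn; omega)
    exact (main (insert w b) ((hmemQ _).2 ⟨K.down_closed hφ.1 (Finset.insert_subset hw hbφ),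
      Finset.ssubset_insert hwb⟩) (Finset.card_insert_of_notMem hwb)).full
  have hQ : ∀ x ∈ Q, b < x := fun x hx => ((hmemQ x).1 hx).2
  have hQ' : ∀ y ∈ Q, Finset.Ioo b y ⊆ Q := fun y hy x hx => by
    rw [Finset.mem_Ioo] at hx
    exact (hmemQ x).2 ⟨K.down_closed ((hmemQ y).1 hy).1 hx.2.1, hx.1⟩
  have hup : ∀ u, b < u → upperPart Q u = upperPart F u := by
    intro u hu
    ext x
    rw [mem_upperPart (Q := Q), hmemQ, mem_upperPart, hF]
    exact ⟨fun h => ⟨h.1.1, h.2⟩, fun h => ⟨⟨h.1, hu.trans h.2⟩, h.2⟩⟩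
  intro τ hτ hτc
  have hbτ := hQ τ hτ
  obtain ⟨w, hwτ, hwb⟩ := Finset.exists_of_ssubset hbτ
  have hτw : τ = b ∪ {w} := by
    rw [Finset.union_comm, Finset.singleton_union]
    refine (Finset.eq_of_subset_of_card_le (Finset.insert_subset hwτ hbτ.1) ?_).symm
    rw [Finset.card_insert_of_notMem hwb, hτc]
  have hdw : Disjoint b {w} := by simpa using hwb
  -- adding facets
  have facets : ∀ A ⊆ Q, (∀ u ∈ Q, u ∉ A → K.IsFacet u ∧ Finset.Ioo b u ⊆ A) →
      ReflTransGen (PrefixStep n Q false) A Q := by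
    intro A hA h
    refine prefixPath_of_nbrs_subset hA fun u hu huA => ?_
    obtain ⟨hfac, hsub⟩ := h u hu huA
    have e : nbrs Q u = Finset.Ioo b u := by
      rw [nbrs_eq_Ioo_union_upperPart hQ hQ' hu]
      convert Finset.union_empty _
      refine Finset.eq_empty_of_forall_notMem fun x hx => ?_
      rw [mem_upperPart, hmemQ] at hx
      exact hx.2.ne' (hfac.2 x hx.1.1 hx.2.1)
    rw [e]
    refine ⟨hsub, (atomPrefix_Ioo n b u (hQ u hu) ?_).1⟩
    have := hpure.2 u hfac
    push_cast at hbn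
    omega
  refine ⟨τ, hτ, ?_, .refl, ?_⟩
  · rw [nbrs_eq_Ioo_union_upperPart hQ hQ' hτ, Ioo_eq_empty_of_card (by omega),
      Finset.empty_union, hup τ hbτ]
    exact (ih n (by omega) τ ((hmemQ τ).1 hτ).1 (by push_cast at hbn; omega)).1
  -- Zero-dimensional links are treated apart: there `{w}` is itself a facet of the link and may be
  -- among those removed before collapsing.
  rcases n with _ | n
  · refine facets {τ} (by simpa using hτ) fun u hu _ => ?_
    have hbu := Finset.card_lt_card (hQ u hu)
    have hu1 := hpure.card_le ((hmemQ u).1 hu).1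
    push_cast at hbn
    refine ⟨⟨((hmemQ u).1 hu).1, fun x hx hux => ?_⟩, ?_⟩
    · have := hpure.card_le hx
      exact (Finset.eq_of_subset_of_card_le hux (by omega)).symm
    · rw [Ioo_eq_empty_of_card (by omega)]
      exact Finset.empty_subset _
  -- the pairs of the collapse in reverse order
  have collapse : ∀ M : FinComplex V, ReflTransGen ElementaryCollapse M (simplex {w}) →
      M.faces ⊆ (K.link b).faces →
      ReflTransGen (PrefixStep (n + 1) Q false) {τ} (liftFaces Q b M) := by
    intro M hM
    induction hM using ReflTransGen.head_induction_on with
    | refl =>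
      intro _
      have e : liftFaces Q b (simplex {w}) = {τ} := by
        ext x
        rw [Finset.mem_singleton]
        constructor
        · intro hx
          have hbx := hQ x (liftFaces_subset _ _ _ hx)
          obtain ⟨y, hy, rfl⟩ := exists_eq_union hbx.le
          have := ((mem_liftFaces hy).1 hx).2
          rw [mem_simplex, Finset.subset_singleton_iff] at this
          rcases this with rfl | rfl
          · simp at hbx
          · exact hτw.symm
        · rintro rfl
          rw [hτw] at hτ ⊢
          exact (mem_liftFaces hdw).2 ⟨hτ, Finset.Subset.refl _⟩
      rw [e]
    | @head M M₂ hMM₂ hM₂ ihM =>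
      intro hMK
      obtain ⟨s, t, hs, ht, hst, hfree, e⟩ := hMM₂
      have hmem : ∀ ρ, ρ ∈ M₂ ↔ ρ ∈ M ∧ ρ ≠ s ∧ ρ ≠ t := by
        intro ρ
        rw [← mem_faces, e]
        simp only [Set.mem_sdiff, Set.mem_insert_iff, Set.mem_singleton_iff, not_or, mem_faces]
      have hs0 : s.Nonempty := Finset.nonempty_iff_ne_empty.2 fun h0 =>
        ((hmem ∅).1 (empty_mem_of_collapse hM₂)).2.1 h0.symm
      have hlink : ∀ {y}, y ∈ M → y.Nonempty → Disjoint b y ∧ b ∪ y ∈ Q := by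
        intro y hy hy0
        obtain ⟨h1, h2⟩ := hMK hy
        refine ⟨h1, (hmemQ _).2 ⟨h2, ?_⟩⟩
        have := (union_lt_union_iff (Finset.disjoint_empty_right b) h1).2
          (Finset.empty_ssubset.2 hy0)
        rwa [Finset.union_empty] at this
      obtain ⟨hbs, hsQ⟩ := hlink hs hs0
      obtain ⟨hbt, htQ⟩ := hlink ht (hs0.mono hst.1)
      obtain ⟨x₀, hx₀t, hx₀s⟩ := Finset.exists_of_ssubset hst
      have hts := eq_insert_of_free ht hst hfree hx₀t hx₀s
      have hx₀b : x₀ ∉ b := fun h => Finset.disjoint_left.1 hbt h hx₀t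
      have hbts : b ∪ t = insert x₀ (b ∪ s) := by rw [← hts, Finset.union_insert]
      have hx₀bs : x₀ ∉ b ∪ s := by simp [hx₀b, hx₀s]
      have hcs : (b ∪ s).card = b.card + s.card := Finset.card_union_of_disjoint hbs
      have hct : (b ∪ t).card = b.card + s.card + 1 := by
        rw [hbts, Finset.card_insert_of_notMem hx₀bs, hcs]
      have hscard := hs0.card_pos
      have htle := hpure.card_le ((hmemQ _).1 htQ).1
      have hlt : b ∪ s < b ∪ t := (union_lt_union_iff hbs hbt).2 hst
      have htM₂ : t ∉ M₂ := fun h => ((hmem t).1 h).2.2 rfl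
      have hsM₂ : s ∉ M₂ := fun h => ((hmem s).1 h).2.1 rfl
      -- Hence earlier faces lie only below the new pair, as `prefixPath_pair` demands.
      have above : ∀ y ∈ M₂, ¬ s < y := fun y hy h =>
        htM₂ (hfree y ((hmem y).1 hy).1 h ▸ hy)
      have eL : liftFaces Q b M = insert (b ∪ s) (insert (b ∪ t) (liftFaces Q b M₂)) := by
        ext x
        simp only [Finset.mem_insert]
        constructor
        · intro hx
          obtain ⟨y, hy, rfl⟩ := exists_eq_union (hQ x (liftFaces_subset _ _ _ hx)).le
          obtain ⟨h1, h2⟩ := (mem_liftFaces hy).1 hx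
          by_cases hys : y = s
          · exact .inl (by rw [hys])
          by_cases hyt : y = t
          · exact .inr (.inl (by rw [hyt]))
          exact .inr (.inr ((mem_liftFaces hy).2 ⟨h1, (hmem y).2 ⟨h2, hys, hyt⟩⟩))
        · rintro (rfl | rfl | hx)
          · exact (mem_liftFaces hbs).2 ⟨hsQ, hs⟩
          · exact (mem_liftFaces hbt).2 ⟨htQ, ht⟩
          · obtain ⟨y, hy, rfl⟩ := exists_eq_union (hQ x (liftFaces_subset _ _ _ hx)).le
            obtain ⟨h1, h2⟩ := (mem_liftFaces hy).1 hx
            exact (mem_liftFaces hy).2 ⟨h1, ((hmem y).1 h2).1⟩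
      have hM₂K : M₂.faces ⊆ (K.link b).faces := fun y hy => hMK ((hmem y).1 hy).1
      rw [eL]
      push_cast at hbn
      -- The lower parameters come from `t` having one element more than `s`, the upper ones from
      -- `b.card + n + 2 = d + 1`. No subtraction truncates, since `s` is nonempty and `b ∪ t` has
      -- at most `d + 1` elements.
      refine (ihM hM₂K).trans (prefixPath_weaken (prefixPath_pair (k₁ := s.card)
        (m₁ := n + 1 - s.card) (k₀ := s.card - 1) (m₀ := n + 2 - s.card) hQ hQ' hsQ htQ hlt
        (fun h => hsM₂ ((mem_liftFaces hbs).1 h).2) (fun h => htM₂ ((mem_liftFaces hbt).1 h).2)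
        ?_ ?_ ?_ ?_ (by omega) ?_ ?_ (by omega)))
      · intro x
        constructor
        · rintro ⟨hx, h⟩
          have hbx := hQ x (liftFaces_subset _ _ _ hx)
          obtain ⟨y, hy, rfl⟩ := exists_eq_union hbx.le
          have hyM := ((mem_liftFaces hy).1 hx).2
          rw [union_lt_union_iff hy hbt, union_lt_union_iff hbt hy] at h
          refine ⟨⟨hbx, (union_lt_union_iff hy hbt).2 (h.resolve_right fun h =>
            above y hyM (hst.trans h))⟩, fun e => hsM₂ ?_⟩
          rw [e] at hx
          exact ((mem_liftFaces hbs).1 hx).2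
        · rintro ⟨⟨h1, h2⟩, h3⟩
          have hxQ := hQ' _ htQ (Finset.mem_Ioo.2 ⟨h1, h2⟩)
          refine ⟨?_, .inl h2⟩
          obtain ⟨y, hy, rfl⟩ := exists_eq_union h1.le
          have hyt := (union_lt_union_iff hy hbt).1 h2
          exact (mem_liftFaces hy).2 ⟨hxQ, (hmem y).2 ⟨M.down_closed ht hyt.1,
            fun e => h3 (by rw [e]), hyt.ne⟩⟩
      · intro x
        constructor
        · rintro ⟨hx, h⟩
          have hbx := hQ x (liftFaces_subset _ _ _ hx)
          obtain ⟨y, hy, rfl⟩ := exists_eq_union hbx.le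
          have hyM := ((mem_liftFaces hy).1 hx).2
          rw [union_lt_union_iff hy hbs, union_lt_union_iff hbs hy] at h
          exact ⟨hbx, (union_lt_union_iff hy hbs).2 (h.resolve_right (above y hyM))⟩
        · rintro ⟨h1, h2⟩
          have hxQ := hQ' _ hsQ (Finset.mem_Ioo.2 ⟨h1, h2⟩)
          refine ⟨?_, .inl h2⟩
          obtain ⟨y, hy, rfl⟩ := exists_eq_union h1.le
          have hys := (union_lt_union_iff hy hbs).1 h2
          exact (mem_liftFaces hy).2 ⟨hxQ, (hmem y).2 ⟨M.down_closed hs hys.1, hys.ne,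
            (hys.trans hst).ne⟩⟩
      · have := (atomPrefix_Ioo s.card b (b ∪ t) (hQ _ htQ) (by omega)).2.2 x₀
          (Finset.mem_union_right _ hx₀t) hx₀b
        rw [hbts, Finset.erase_insert hx₀bs] at this
        rw [hbts]
        exact this (hQ _ hsQ)
      · rw [hup _ (hQ _ htQ)]
        exact (ih _ (by omega) _ ((hmemQ _).1 htQ).1 (by omega)).1
      · exact (atomPrefix_Ioo (s.card - 1) b (b ∪ s) (hQ _ hsQ) (by omega)).1
      · rw [hup _ (hQ _ hsQ)]
        exact (ih _ (by omega) _ ((hmemQ _).1 hsQ).1 (by omega)).2 _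
          (mem_upperPart.2 ⟨(hF _).2 ((hmemQ _).1 htQ).1, hlt⟩) (by omega)
  have hwK : {w} ∈ K.link b := ⟨hdw, by rw [← hτw]; exact ((hmemQ τ).1 hτ).1⟩
  have hfacet : ∀ {φ}, (K.link b).IsFacet φ → K.IsFacet (b ∪ φ) := by
    intro φ hφ
    refine ⟨hφ.1.2, fun x hx hφx => ?_⟩
    obtain ⟨y, hy, rfl⟩ := exists_eq_union (Finset.union_subset_left hφx)
    rw [hφ.2 y ⟨hy, hx⟩ fun z hz => (Finset.mem_union.1 (hφx (Finset.mem_union_right _ hz))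
      ).resolve_left fun hzb => Finset.disjoint_left.1 hφ.1.1 hzb hz]
  rcases hHRC b hb with h0 | ⟨Φ, hΦ, L, hL, v, hLv⟩
  · exact absurd (h0 _ hwK) (Finset.singleton_ne_empty w)
  have hmemL : ∀ y, y ∈ L ↔ y ∈ K.link b ∧ y ∉ Φ := fun y => by
    rw [← mem_faces, hL]; exact Iff.rfl
  -- The link of `b` now has dimension at least 1, so `{w}` is not a facet and survives the removal.
  have hwL : {w} ∈ L := by
    refine (hmemL _).2 ⟨hwK, fun h => ?_⟩
    have := hpure.2 _ (hfacet (hΦ _ h))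
    rw [← hτw] at this
    push_cast at hbn
    omega
  -- After the reversed collapse towards `w` only the removed facets are missing. Their proper faces
  -- all lie in `L`, because a proper face of a facet is not a facet.
  refine (collapse L (collapse_to_vertex hLv hwL) fun y hy => ((hmemL y).1 hy).1).trans
    (facets _ (liftFaces_subset _ _ _) fun u hu huL => ?_)
  obtain ⟨y, hy, rfl⟩ := exists_eq_union (hQ u hu).le
  have hyK : y ∈ K.link b := ⟨hy, ((hmemQ _).1 hu).1⟩
  have hyΦ : y ∈ Φ := by
    by_contra h
    exact huL ((mem_liftFaces hy).2 ⟨hu, (hmemL y).2 ⟨hyK, h⟩⟩)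
  refine ⟨hfacet (hΦ y hyΦ), fun x hx => ?_⟩
  have hxQ := hQ' _ hu hx
  rw [Finset.mem_Ioo] at hx
  obtain ⟨z, hz, rfl⟩ := exists_eq_union hx.1.le
  have hzy := (union_lt_union_iff hz hy).1 hx.2
  refine (mem_liftFaces hz).2 ⟨hxQ, (hmemL z).2 ⟨(K.link b).down_closed hyK hzy.1, fun h => ?_⟩⟩
  exact hzy.ne' ((hΦ z h).2 y hyK hzy.1)

end MainInduction

end FinComplex

theorem theorem1 {V : Type*} [DecidableEq V] (K : FinComplex V) (d : ℤ)
    (hpure : K.PureOfDim d) (hHRC : K.HRC) :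
    K.sd.sd.Shellable ∧ K.sd.sd.VertexDecomposable := by
  have hF : ∀ σ, σ ∈ K.finite_faces.toFinset ↔ σ ∈ K := fun σ => K.finite_faces.mem_toFinset
  have h0 : ∅ ∈ K := by
    obtain ⟨σ, hσ⟩ := hpure.1
    exact K.down_closed hσ (Finset.empty_subset _)
  have hd : (0 : ℤ) ≤ d + 1 := by simpa using hpure.card_le h0
  -- The faces properly above `∅` are the nonempty ones, so `b = ∅` gives the ordering of all of sd
  -- K.
  have key := (FinComplex.atomPrefix_upperPart hpure hHRC hF (d + 1).toNat ∅ h0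
    (by rw [Finset.card_empty, Int.toNat_of_nonneg hd]; simp)).1
  set Q := upperPart K.finite_faces.toFinset ∅
  have hQ : ∀ σ, σ ∈ Q ↔ σ ∈ K ∧ σ.Nonempty := fun σ => by
    rw [mem_upperPart, hF, Finset.empty_ssubset]
  have e : commonNbrs Q ∅ = Q := by
    ext σ
    simp [mem_commonNbrs]
  have hVD := FinComplex.vertexDecomposable_orderComplex (orderVD_chainsMeeting (Q := Q) _ ∅ Q
    (Finset.empty_subset _) (by simp) (by rwa [e]))
  rw [← FinComplex.sd_sd_eq_orderComplex K hQ] at hVD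
  exact ⟨hVD.2.shellable hVD.1, hVD.2⟩
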